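/- Matrices and divisions. For totally ordered sets $X,Y$, a binary $X\times Y$ matrix is a relation $M\subseteq X\times Y$ (its $1$-entries). A division of $M$ consists of a partition of $X$ and a partition of $Y$ into intervals; the corresponding quotient matrix has the parts as indices and a $1$-entry at $(A,B)$ iff $M$ has a $1$-entry in $A\times B$. For finite non-empty $M$, the (strict) twin-width $\mathrm{stww}(M)$ is the least $t$ for which there is a sequence of divisions, starting with the division into singletons, ending with the division having one part on each side, and merging at each step two parts of $X$ or two parts of $Y$, such that every row and every column of every quotient matrix of the sequence has at most $t$ $1$-entries. For infinite $M$, $\mathrm{stww}(M)$ is the supremum of $\mathrm{stww}(M')$ over all finite non-empty submatrices $M'$. The grid number $\mathrm{gn}(M)$ is the supremum of all $k$ such that there are partitions of $X$ and of $Y$ into $k$ intervals each for which all $k^2$ entries of the quotient matrix are $1$. Graphs. For a finite non-empty graph $G$, the (strict) twin-width $\mathrm{stww}(G)$ is the least $t$ for which there is a sequence of partitions of $V(G)$, starting with the partition into singletons, ending with the partition into one part, and merging two parts at each step, such that every quotient graph of the sequence has maximum degree at most $t$; here the vertices of the quotient graph are the parts, and two distinct parts are adjacent iff $G$ has an edge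 between them. For infinite $G$, $\mathrm{stww}(G)$ is the supremum of $\mathrm{stww}(H)$ over all finite non-empty induced subgraphs $H$ of $G$. The grid number $\mathrm{gn}(G)$ is the minimum, over all total orders on $V(G)$, of the grid number of the adjacency matrix of $G$. For a group $\Gamma$ and a finite generating set $S$, $\mathrm{Cay}(\Gamma,S)$ is the simple graph on $\Gamma$ in which $x\ne y$ are adjacent iff $x^{-1}y\in S\cup S^{-1}$. For a total order $<$ on $\Gamma$ and $g\in\Gamma$, $M_g^{<}$ is the matrix with rows and columns indexed by $(\Gamma,<)$ whose $1$-entries are the pairs $(x,xg)$, $x\in\Gamma$. **Lemma 5.1.** Let $\Gamma$ be a finitely generated group. The following are equivalent. 1. $\mathrm{stww}(\mathrm{Cay}(\Gamma,S))<\infty$ for some finite generating set $S$ of $\Gamma$. 2. $\mathrm{stww}(\mathrm{Cay}(\Gamma,S))<\infty$ for every finite generating set $S$ of $\Gamma$. 3. $\mathrm{gn}(\mathrm{Cay}(\Gamma,S))<\infty$ for some finite generating set $S$ of $\Gamma$. 4. $\mathrm{gn}(\mathrm{Cay}(\Gamma,S))<\infty$ for every finite generating set $S$ of $\Gamma$.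 5. There is a total order $<$ on $\Gamma$ such that $\mathrm{stww}(M_g^{<})<\infty$ for every $g\in\Gamma$. 6. There is a total order $<$ on $\Gamma$ such that $\mathrm{gn}(M_g^{<})<\infty$ for every $g\in\Gamma$. -/

import Mathlib

namespace TwinWidth

/-! ### Partitions and merging

Partitions of a set `V` are represented by equivalence relations `Setoid V`; the parts are the
points of the quotient. -/

/-- `s` is obtained from the partition `r` by merging two distinct parts (those of `a` and `b`)
and leaving all other parts unchanged. -/
def MergesTwo {V : Type*} (r s : Setoid V) : Prop :=
  ∃ a b : V, ¬ r.r a b ∧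
    ∀ x y : V, s.r x y ↔ (r.r x y ∨ ((r.r x a ∨ r.r x b) ∧ (r.r y a ∨ r.r y b)))

/-! ### Strict twin-width of graphs -/

/-- The quotient graph `G / r`: the vertices are the parts, and two distinct parts are adjacent
if and only if there is an edge of `G` between them. -/
def quotientGraph {V : Type*} (G : SimpleGraph V) (r : Setoid V) :
    SimpleGraph (Quotient r) where
  Adj A B := A ≠ B ∧ ∃ x y : V, Quotient.mk r x = A ∧ Quotient.mk r y = B ∧ G.Adj x y
  symm := ⟨fun _ _ h => ⟨h.1.symm, by
    obtain ⟨x, y, hx, hy, hxy⟩ := h.2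
    exact ⟨y, x, hy, hx, hxy.symm⟩⟩⟩
  loopless := ⟨fun _ h => h.1 rfl⟩

/-- The maximum degree of a graph (`⊤` if the degrees are unbounded or infinite). -/
noncomputable def graphMaxDegree {V : Type*} (G : SimpleGraph V) : ℕ∞ :=
  ⨆ v : V, (G.neighborSet v).encard

/-- A partition sequence of `V`: it starts with the partition into singletons, ends with the
trivial partition, and at each step merges two parts. Only the values `part i` for `i ≤ length`
are meaningful. -/
structure PartitionSequence (V : Type*) where
  length : ℕ
  part : ℕ → Setoid V
  part_zero : part 0 = ⊥
  part_length : part length = ⊤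
  merges : ∀ i < length, MergesTwo (part i) (part (i + 1))

/-- The width of a partition sequence: the maximum degree of all its quotient graphs. -/
noncomputable def PartitionSequence.width {V : Type*} (P : PartitionSequence V)
    (G : SimpleGraph V) : ℕ∞ :=
  ⨆ i : {i : ℕ // i ≤ P.length}, graphMaxDegree (quotientGraph G (P.part i))

/-- The strict twin-width of a finite graph: the minimum width of a partition sequence. (To be
used for finite vertex sets only; the empty graph has strict twin-width `0`.) -/
noncomputable def finGraphStww {V : Type*} (G : SimpleGraph V) : ℕ∞ :=
  ⨅ P : PartitionSequence V, P.width G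

/-- The strict twin-width of a possibly infinite graph: the supremum of the strict twin-widths of
its finite induced subgraphs. -/
noncomputable def graphStww {V : Type*} (G : SimpleGraph V) : ℕ∞ :=
  ⨆ H : Finset V, finGraphStww (G.induce (H : Set V))

/-! ### Strict twin-width of binary matrices

A binary `X × Y` matrix, with `X` and `Y` totally ordered, is a relation `M : X → Y → Prop`. -/

/-- The quotient matrix with respect to partitions of `X` and `Y`: its entry at a pair of parts is
`1` if and only if the corresponding zone of `M` contains a `1`. -/
def quotientMatrix {X Y : Type*} (M : X → Y → Prop) (r : Setoid X) (s : Setoid Y) :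
    Quotient r → Quotient s → Prop :=
  fun A B => ∃ x y, Quotient.mk r x = A ∧ Quotient.mk s y = B ∧ M x y

/-- The maximum over all rows and all columns of the number of `1`-entries. -/
noncomputable def matrixMaxDegree {X Y : Type*} (M : X → Y → Prop) : ℕ∞ :=
  (⨆ x : X, {y : Y | M x y}.encard) ⊔ (⨆ y : Y, {x : X | M x y}.encard)

/-- All parts of the partition are intervals of the order. -/
def IsIntervalPartition {X : Type*} [LinearOrder X] (r : Setoid X) : Prop :=
  ∀ a : X, Set.OrdConnected {x : X | r.r x a}

/-- A division sequence for `X × Y` matrices: it starts with the division into singletons, ends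
with the trivial division, consists of divisions into intervals only, and at each step either
merges two parts of `X` or merges two parts of `Y`. Only the values at indices `i ≤ length` are
meaningful. -/
structure DivisionSequence (X Y : Type*) [LinearOrder X] [LinearOrder Y] where
  length : ℕ
  col : ℕ → Setoid X
  row : ℕ → Setoid Y
  col_interval : ∀ i ≤ length, IsIntervalPartition (col i)
  row_interval : ∀ i ≤ length, IsIntervalPartition (row i)
  col_zero : col 0 = ⊥
  row_zero : row 0 = ⊥
  col_length : col length = ⊤
  row_length : row length = ⊤
  merges : ∀ i < length,
    (MergesTwo (col i) (col (i + 1)) ∧ row (i + 1) = row i) ∨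
    (col (i + 1) = col i ∧ MergesTwo (row i) (row (i + 1)))

/-- The width of a division sequence: the maximum degree of a row or column in any of the quotient
matrices. -/
noncomputable def DivisionSequence.width {X Y : Type*} [LinearOrder X] [LinearOrder Y]
    (D : DivisionSequence X Y) (M : X → Y → Prop) : ℕ∞ :=
  ⨆ i : {i : ℕ // i ≤ D.length}, matrixMaxDegree (quotientMatrix M (D.col i) (D.row i))

/-- The strict twin-width of a finite matrix: the minimum width of a division sequence. (To be
used for finite `X` and `Y` only.) -/
noncomputable def finMatrixStww {X Y : Type*} [LinearOrder X] [LinearOrder Y]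
    (M : X → Y → Prop) : ℕ∞ :=
  ⨅ D : DivisionSequence X Y, D.width M

/-- The strict twin-width of a possibly infinite matrix: the supremum of the strict twin-widths of
its finite submatrices. -/
noncomputable def matrixStww {X Y : Type*} [LinearOrder X] [LinearOrder Y]
    (M : X → Y → Prop) : ℕ∞ :=
  ⨆ (X' : Finset X) (Y' : Finset Y),
    finMatrixStww (fun (x : {x : X // x ∈ X'}) (y : {y : Y // y ∈ Y'}) => M x y)

/-! ### Grid number -/

/-- `M` has a `k`-grid: there is a `k × k` division all of whose zones are non-zero. A division of
a totally ordered set into `k` intervals `X_1 < ⋯ < X_k` is given by the monotone map sending each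
element to the index of its interval; that this map is onto is implied by the zones being
non-zero. -/
def HasGrid {X Y : Type*} [LinearOrder X] [LinearOrder Y] (M : X → Y → Prop) (k : ℕ) : Prop :=
  ∃ (c : X → Fin k) (r : Y → Fin k), Monotone c ∧ Monotone r ∧
    ∀ i j : Fin k, ∃ x y, c x = i ∧ r y = j ∧ M x y

/-- The grid number of a matrix: the supremum of the sizes of its grids. -/
noncomputable def matrixGridNumber {X Y : Type*} [LinearOrder X] [LinearOrder Y]
    (M : X → Y → Prop) : ℕ∞ :=
  ⨆ k : {k : ℕ // HasGrid M k}, ((k : ℕ) : ℕ∞)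

/-- The grid number of a graph: the minimum, over all total orders on the vertices, of the grid
number of the adjacency matrix. -/
noncomputable def graphGridNumber {V : Type*} (G : SimpleGraph V) : ℕ∞ :=
  ⨅ o : LinearOrder V, @matrixGridNumber V V o o G.Adj

/-! ### Group actions -/

/-- The matrix of a map `f : X → Y`; for `f` a bijection this is the bijection matrix of `f`. -/
def mapMatrix {X Y : Type*} (f : X → Y) : X → Y → Prop :=
  fun x y => f x = y

/-- A group action has finite twin-width if for some total order on `X`, the bijection matrix of
each group element acting on `X` has finite strict twin-width (with no uniform bound required). -/
def ActionFiniteTwinWidth (G X : Type*) [Group G] [MulAction G X] : Prop :=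
  ∃ _o : LinearOrder X, ∀ g : G, matrixStww (mapMatrix (fun x : X => g • x)) < ⊤

/-- A group action has finite grid number if for some total order on `X`, the bijection matrix of
each group element acting on `X` has finite grid number (with no uniform bound required). -/
def ActionFiniteGridNumber (G X : Type*) [Group G] [MulAction G X] : Prop :=
  ∃ _o : LinearOrder X, ∀ g : G, matrixGridNumber (mapMatrix (fun x : X => g • x)) < ⊤

end TwinWidth

namespace TwinWidth

/-! ### Grids -/

section Grid

variable {X Y A B : Type*} [LinearOrder X] [LinearOrder Y] [LinearOrder A] [LinearOrder B]

/-! Finiteness of strict twin-width and of grid number agree for matrices with boundedly many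
`1`-entries per row and column, and for graphs of bounded degree. Everything then reduces to grid
numbers of the matrices of right multiplications.

Twin-width bounds grids: in a sequence of width `t`, look at the first part that meets three
intervals of a `k`-grid. It contains the middle interval, so it sees all `k` intervals on the other
side, but through few parts, each meeting few intervals; hence `k` is linear in `t`
(`PartitionSequence.grid_le`, `DivisionSequence.grid_le`). For an infinite graph, the orders found
on finite subgraphs are glued along an ultrafilter (`exists_linearOrder_not_hasGrid`).

Grids bound twin-width: by Marcus–Tardos (`exists_card_le_of_not_hasGrid`) a relation without
`k`-grids has linearly many entries, so on average two consecutive rows are sparse and can be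
merged; the resulting bound does not worsen as merging continues (`exists_rowDegreeLE_predAbove`).

For a fixed order on the group, the elements whose matrix has finite grid number form a subgroup,
composition being the hard case (`matrixGridNumber_comp_lt_top`). If it contains one generating set
it is everything; conversely a Cayley graph is covered by finitely many such matrices
(`matrixGridNumber_lt_top_of_union`). One order therefore serves all finite generating sets. -/

/-- Send `z` to the largest `i` such that some point of the `i`-th family is at most `z`, and to `0`
if there is none. -/
theorem exists_monotone_index {ι : Type*} {k : ℕ} (hk : 0 < k) (x : Fin k → ι → X)
    (hx : ∀ i i' a b, i < i' → x i a < x i' b) :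
    ∃ c : X → Fin k, Monotone c ∧ ∀ i a, c (x i a) = i := by
  classical
  have : NeZero k := ⟨hk.ne'⟩
  refine ⟨fun z => (Finset.univ.filter fun i => ∃ a, x i a ≤ z).sup id, fun z w hzw => ?_,
    fun i a => le_antisymm ?_ ?_⟩
  · refine Finset.sup_mono fun i hi => ?_
    simp only [Finset.mem_filter, Finset.mem_univ, true_and] at hi ⊢
    exact hi.imp fun a ha => ha.trans hzw
  · refine Finset.sup_le fun j hj => ?_
    simp only [Finset.mem_filter, Finset.mem_univ, true_and] at hj
    obtain ⟨b, hb⟩ := hj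
    exact not_lt.1 fun h => (hx i j a b h).not_ge hb
  · exact Finset.le_sup (f := id) (Finset.mem_filter.2 ⟨Finset.mem_univ _, a, le_rfl⟩)

/-- A grid can be given by representatives of its zones. -/
theorem hasGrid_of_points {M : X → Y → Prop} {k : ℕ} (hk : 0 < k) (x : Fin k → Fin k → X)
    (y : Fin k → Fin k → Y) (hx : ∀ i i' j j', i < i' → x i j < x i' j')
    (hy : ∀ i i' j j', j < j' → y i j < y i' j') (hM : ∀ i j, M (x i j) (y i j)) :
    HasGrid M k := by
  obtain ⟨c, hc, hcx⟩ := exists_monotone_index hk x hx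
  obtain ⟨r, hr, hry⟩ := exists_monotone_index hk (fun j i => y i j)
    (fun j j' i i' h => hy i i' j j' h)
  exact ⟨c, r, hc, hr, fun i j => ⟨x i j, y i j, hcx i j, hry j i, hM i j⟩⟩

theorem HasGrid.exists_points {M : X → Y → Prop} {k : ℕ} (h : HasGrid M k) :
    ∃ (x : Fin k → Fin k → X) (y : Fin k → Fin k → Y),
      (∀ i i' j j', i < i' → x i j < x i' j') ∧ (∀ i i' j j', j < j' → y i j < y i' j') ∧
      ∀ i j, M (x i j) (y i j) := by
  obtain ⟨c, r, hc, hr, h⟩ := h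
  choose x y hx hy hM using h
  refine ⟨x, y, fun i i' j j' hi => ?_, fun i i' j j' hj => ?_, hM⟩
  · exact hc.reflect_lt (by rwa [hx, hx])
  · exact hr.reflect_lt (by rwa [hy, hy])

/-- Monotone maps pull intervals back to intervals. Applied to index maps of divisions, this shows
that a quotient matrix has no grid that `M` lacks. -/
theorem HasGrid.comap {M : X → Y → Prop} {Q : A → B → Prop} {k : ℕ} (h : HasGrid Q k)
    {f : X → A} {g : Y → B} (hf : Monotone f) (hg : Monotone g)
    (hQ : ∀ a b, Q a b → ∃ x y, f x = a ∧ g y = b ∧ M x y) : HasGrid M k := by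
  obtain ⟨c, r, hc, hr, h⟩ := h
  refine ⟨c ∘ f, r ∘ g, hc.comp hf, hr.comp hg, fun i j => ?_⟩
  obtain ⟨a, b, rfl, rfl, hab⟩ := h i j
  obtain ⟨x, y, rfl, rfl, hM⟩ := hQ a b hab
  exact ⟨x, y, rfl, rfl, hM⟩

theorem HasGrid.map {M : X → Y → Prop} {Q : A → B → Prop} {k : ℕ} (hk : 0 < k) (h : HasGrid M k)
    {f : X → A} {g : Y → B} (hf : StrictMono f) (hg : StrictMono g)
    (hQ : ∀ x y, M x y → Q (f x) (g y)) : HasGrid Q k := by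
  obtain ⟨x, y, hx, hy, hM⟩ := h.exists_points
  exact hasGrid_of_points hk (fun i j => f (x i j)) (fun i j => g (y i j))
    (fun i i' j j' h => hf (hx i i' j j' h)) (fun i i' j j' h => hg (hy i i' j j' h))
    fun i j => hQ _ _ (hM i j)

theorem HasGrid.mono {M M' : X → Y → Prop} {k : ℕ} (h : HasGrid M k)
    (hM : ∀ x y, M x y → M' x y) : HasGrid M' k :=
  h.comap monotone_id monotone_id fun a b hab => ⟨a, b, rfl, rfl, hM a b hab⟩

theorem HasGrid.flip {M : X → Y → Prop} {k : ℕ} (h : HasGrid M k) :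
    HasGrid (fun y x => M x y) k := by
  obtain ⟨c, r, hc, hr, h⟩ := h
  refine ⟨r, c, hr, hc, fun i j => ?_⟩
  obtain ⟨x, y, hx, hy, hM⟩ := h j i
  exact ⟨y, x, hy, hx, hM⟩

theorem HasGrid.of_le {M : X → Y → Prop} {k l : ℕ} (h : HasGrid M k) (hl : 0 < l) (hlk : l ≤ k) :
    HasGrid M l := by
  obtain ⟨x, y, hx, hy, hM⟩ := h.exists_points
  exact hasGrid_of_points hl (fun i j => x (i.castLE hlk) (j.castLE hlk))
    (fun i j => y (i.castLE hlk) (j.castLE hlk)) (fun i i' j j' h => hx _ _ _ _ (by simpa))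
    (fun i i' j j' h => hy _ _ _ _ (by simpa)) fun i j => hM _ _

/-- Grids shrink to every smaller positive size. Size `0` is excluded because a nonempty set has no
map to `Fin 0`, so the absence of a `0`-grid says nothing. -/
theorem matrixGridNumber_lt_top_iff {M : X → Y → Prop} :
    matrixGridNumber M < ⊤ ↔ ∃ k, 0 < k ∧ ¬ HasGrid M k := by
  constructor
  · intro h
    obtain ⟨n, hn⟩ := ENat.ne_top_iff_exists.1 h.ne
    refine ⟨n + 1, n.succ_pos, fun hg => ?_⟩
    have := le_iSup (fun k : {k : ℕ // HasGrid M k} => ((k : ℕ) : ℕ∞)) ⟨n + 1, hg⟩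
    change _ ≤ matrixGridNumber M at this
    rw [← hn] at this
    have : n + 1 ≤ n := by exact_mod_cast this
    omega
  · rintro ⟨k, hk, hg⟩
    refine lt_of_le_of_lt (b := (k : ℕ∞)) (iSup_le fun l => ?_) (ENat.natCast_lt_top k)
    exact_mod_cast le_of_not_ge fun h => hg (l.2.of_le hk h)

end Grid

/-! ### The Marcus–Tardos theorem -/

section MarcusTardos

open Finset

/-- The points of `E` in a given block form a wide block if they occupy at least `k` columns; if
`E` has no `k`-grid, then each block column has few wide blocks. -/
theorem card_wide_blocks_le {k b : ℕ} (hk : 0 < k) (hb : 0 < b) (E : Finset (ℕ × ℕ))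
    (hE : ¬ HasGrid (fun a b => (a, b) ∈ E) k) (i : ℕ) (J : Finset ℕ)
    (hJ : ∀ j ∈ J, k ≤ ((E.filter fun p => p.1 / b = i ∧ p.2 / b = j).image Prod.fst).card) :
    J.card ≤ k * 2 ^ b := by
  by_contra hcard
  push Not at hcard
  let S : ℕ → Finset ℕ := fun j => (E.filter fun p => p.1 / b = i ∧ p.2 / b = j).image Prod.fst
  have hS : ∀ j ∈ J, S j ∈ (Finset.Ico (i * b) (i * b + b)).powerset := by
    intro j _
    rw [Finset.mem_powerset]
    intro a ha
    simp only [S, Finset.mem_image, Finset.mem_filter] at ha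
    obtain ⟨p, ⟨-, hp, -⟩, rfl⟩ := ha
    rw [Finset.mem_Ico]
    have h1 := Nat.div_mul_le_self p.1 b
    have h2 := Nat.lt_div_mul_add hb (a := p.1)
    rw [hp] at h1 h2
    exact ⟨h1, h2⟩
  -- Only `2 ^ b` sets of first coordinates are possible, so more than `k` of the blocks share the
  -- same set `s`. Any `k` elements of `s` and `k` of these blocks form a grid.
  obtain ⟨s, -, hs⟩ := Finset.exists_lt_card_fiber_of_mul_lt_card_of_maps_to (n := k) hS (by
    rw [Finset.card_powerset, Nat.card_Ico, Nat.add_sub_cancel_left, mul_comm]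
    exact hcard)
  set J' := J.filter fun j => S j = s with hJ'
  obtain ⟨T, hTJ, hT⟩ := Finset.exists_subset_card_eq hs.le
  have hks : k ≤ s.card := by
    obtain ⟨j, hj⟩ := Finset.card_pos.1 (lt_of_le_of_lt (Nat.zero_le _) hs)
    rw [hJ', Finset.mem_filter] at hj
    rw [← hj.2]
    exact hJ j hj.1
  obtain ⟨U, hUs, hU⟩ := Finset.exists_subset_card_eq hks
  have key : ∀ u v : Fin k, ∃ y, (U.orderEmbOfFin hU u, y) ∈ E ∧ y / b = T.orderEmbOfFin hT v := by
    intro u v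
    have h1 : U.orderEmbOfFin hU u ∈ s := hUs (Finset.orderEmbOfFin_mem _ _ _)
    have h2 := hTJ (Finset.orderEmbOfFin_mem T hT v)
    rw [hJ', Finset.mem_filter] at h2
    rw [← h2.2] at h1
    simp only [S, Finset.mem_image, Finset.mem_filter] at h1
    obtain ⟨p, ⟨hp, -, hp2⟩, hp1⟩ := h1
    exact ⟨p.2, by rw [← hp1]; exact hp, hp2⟩
  choose y hy hyb using key
  refine hE (hasGrid_of_points hk (fun u _ => U.orderEmbOfFin hU u) y
    (fun u u' _ _ h => (U.orderEmbOfFin hU).strictMono h) (fun u u' v v' h => ?_) hy)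
  by_contra hlt
  push Not at hlt
  have := Nat.div_le_div_right (c := b) hlt
  rw [hyb, hyb] at this
  exact this.not_gt ((T.orderEmbOfFin hT).strictMono h)

theorem card_le_of_mem_block {b : ℕ} (hb : 0 < b) (F : Finset (ℕ × ℕ)) (i j : ℕ)
    (hF : ∀ p ∈ F, p.1 / b = i ∧ p.2 / b = j) : F.card ≤ b * b := by
  have : F ⊆ Finset.Ico (i * b) (i * b + b) ×ˢ Finset.Ico (j * b) (j * b + b) := by
    intro p hp
    obtain ⟨h1, h2⟩ := hF p hp
    have a1 := Nat.div_mul_le_self p.1 b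
    have a2 := Nat.lt_div_mul_add hb (a := p.1)
    have b1 := Nat.div_mul_le_self p.2 b
    have b2 := Nat.lt_div_mul_add hb (a := p.2)
    rw [h1] at a1 a2
    rw [h2] at b1 b2
    simp only [Finset.mem_product, Finset.mem_Ico]
    exact ⟨⟨a1, a2⟩, b1, b2⟩
  simpa using Finset.card_le_card this

theorem hasGrid_swap {E : Finset (ℕ × ℕ)} {k : ℕ}
    (h : HasGrid (fun a b => (a, b) ∈ E.image Prod.swap) k) : HasGrid (fun a b => (a, b) ∈ E) k :=
  h.flip.mono fun x y hxy => by
    obtain ⟨p, hp, hp'⟩ := Finset.mem_image.1 hxy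
    simp only [Prod.swap, Prod.mk.injEq] at hp'
    obtain ⟨rfl, rfl⟩ := hp'
    exact hp

/-- One step of the recursion: the number of points is bounded in terms of the number of non-empty
blocks and the number of block rows. -/
theorem card_le_of_blocks {k b m : ℕ} (hk : 0 < k) (hb : 0 < b) (E : Finset (ℕ × ℕ))
    (hE : ¬ HasGrid (fun a b => (a, b) ∈ E) k)
    (hm : ∀ p ∈ E, p.1 / b < m ∧ p.2 / b < m) :
    E.card ≤ k * k * (E.image fun p => (p.1 / b, p.2 / b)).card
      + b * b * (2 * (m * (k * 2 ^ b))) := by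
  classical
  set π : ℕ × ℕ → ℕ × ℕ := fun p => (p.1 / b, p.2 / b) with hπ
  set E' := E.image π with hE'
  let F : ℕ × ℕ → Finset (ℕ × ℕ) := fun q => E.filter fun p => π p = q
  set W := E'.filter fun q => k ≤ ((F q).image Prod.fst).card with hW
  set T := E'.filter fun q => k ≤ ((F q).image Prod.snd).card with hT
  have hE'm : ∀ q ∈ E', q.1 < m ∧ q.2 < m := by
    intro q hq
    obtain ⟨p, hp, rfl⟩ := Finset.mem_image.1 hq
    exact hm p hp
  have hFeq : ∀ q, F q = E.filter fun p => p.1 / b = q.1 ∧ p.2 / b = q.2 := by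
    intro q
    simp only [F, hπ, Prod.ext_iff]
  have hWc : W.card ≤ m * (k * 2 ^ b) := by
    have := Finset.card_le_mul_card_image_of_maps_to (f := Prod.fst) (s := W)
      (t := Finset.range m)
      (fun q hq => Finset.mem_range.2 (hE'm q (Finset.mem_filter.1 hq).1).1) (k * 2 ^ b) ?_
    · rw [Finset.card_range] at this
      rwa [mul_comm]
    intro i _
    rw [← Finset.card_image_of_injOn (f := Prod.snd)]
    · refine card_wide_blocks_le hk hb E hE i _ fun j hj => ?_
      obtain ⟨q, hq, rfl⟩ := Finset.mem_image.1 hj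
      obtain ⟨hqW, rfl⟩ := Finset.mem_filter.1 hq
      rw [← hFeq]
      exact (Finset.mem_filter.1 hqW).2
    · intro q hq q' hq' h
      rw [Finset.mem_coe, Finset.mem_filter] at hq hq'
      exact Prod.ext (hq.2.trans hq'.2.symm) h
  have hTc : T.card ≤ m * (k * 2 ^ b) := by
    have := Finset.card_le_mul_card_image_of_maps_to (f := Prod.snd) (s := T)
      (t := Finset.range m)
      (fun q hq => Finset.mem_range.2 (hE'm q (Finset.mem_filter.1 hq).1).2) (k * 2 ^ b) ?_
    · rw [Finset.card_range] at this
      rwa [mul_comm]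
    intro i _
    rw [← Finset.card_image_of_injOn (f := Prod.fst)]
    · refine card_wide_blocks_le hk hb (E.image Prod.swap) (fun h => hE (hasGrid_swap h)) i _
        fun j hj => ?_
      obtain ⟨q, hq, rfl⟩ := Finset.mem_image.1 hj
      obtain ⟨hqW, rfl⟩ := Finset.mem_filter.1 hq
      refine (Finset.mem_filter.1 hqW).2.trans (Finset.card_le_card ?_)
      intro a ha
      obtain ⟨p, hp, rfl⟩ := Finset.mem_image.1 ha
      rw [hFeq, Finset.mem_filter] at hp
      exact Finset.mem_image.2 ⟨p.swap, Finset.mem_filter.2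
        ⟨Finset.mem_image_of_mem _ hp.1, hp.2.2, hp.2.1⟩, rfl⟩
    · intro q hq q' hq' h
      rw [Finset.mem_coe, Finset.mem_filter] at hq hq'
      exact Prod.ext h (hq.2.trans hq'.2.symm)
  have hsum : E.card = ∑ q ∈ E', (F q).card :=
    Finset.card_eq_sum_card_fiberwise fun p hp => Finset.mem_image_of_mem π hp
  -- A block that is neither wide nor tall lies in a product of two sets of size at most `k`; the
  -- few wide or tall ones are bounded by their area.
  have hbound : ∀ q ∈ E', (F q).card ≤ k * k + if q ∈ W ∪ T then b * b else 0 := by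
    intro q hq
    split_ifs with hqW
    · refine le_add_left (card_le_of_mem_block hb _ q.1 q.2 fun p hp => ?_)
      rw [hFeq, Finset.mem_filter] at hp
      exact hp.2
    · rw [add_zero]
      have h1 : ((F q).image Prod.fst).card ≤ k := by
        by_contra h
        exact hqW (Finset.mem_union_left _ (Finset.mem_filter.2 ⟨hq, (not_le.1 h).le⟩))
      have h2 : ((F q).image Prod.snd).card ≤ k := by
        by_contra h
        exact hqW (Finset.mem_union_right _ (Finset.mem_filter.2 ⟨hq, (not_le.1 h).le⟩))
      calc (F q).card ≤ (((F q).image Prod.fst) ×ˢ ((F q).image Prod.snd)).card :=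
            Finset.card_le_card fun p hp => Finset.mem_product.2
              ⟨Finset.mem_image_of_mem _ hp, Finset.mem_image_of_mem _ hp⟩
        _ ≤ k * k := by rw [Finset.card_product]; exact Nat.mul_le_mul h1 h2
  have hWT : W ∪ T ⊆ E' := Finset.union_subset (Finset.filter_subset _ _) (Finset.filter_subset _ _)
  calc E.card ≤ ∑ q ∈ E', (k * k + if q ∈ W ∪ T then b * b else 0) :=
        hsum ▸ Finset.sum_le_sum hbound
    _ = k * k * E'.card + b * b * (W ∪ T).card := by
        rw [Finset.sum_add_distrib, ← Finset.sum_filter, Finset.filter_mem_eq_inter,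
          Finset.inter_eq_right.2 hWT]
        simp [mul_comm]
    _ ≤ _ := by
        gcongr
        have := Finset.card_union_le W T
        omega

/-- **Marcus–Tardos theorem**, for grids instead of permutation patterns. -/
theorem exists_card_le_of_not_hasGrid (k : ℕ) (hk : 0 < k) :
    ∃ C : ℕ, ∀ (n : ℕ) (E : Finset (ℕ × ℕ)), (∀ p ∈ E, p.1 < n ∧ p.2 < n) →
      ¬ HasGrid (fun a b => (a, b) ∈ E) k → E.card ≤ C * n := by
  -- The recursion has `m ≤ 2 * n / b` block rows, so this `b` makes the term `k * k * (C * m)` at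
  -- most half of `C * n`.
  set b := 4 * (k * k) with hbdef
  have hkk : 0 < k * k := Nat.mul_pos hk hk
  have hb : 0 < b := by omega
  set D := b * b * (2 * (k * 2 ^ b)) with hD
  -- The summand `2 * D` absorbs the error `D * m` of each step; `b` covers the base case, where `n
  -- * n ≤ b * n`.
  refine ⟨2 * D + b, fun n => ?_⟩
  induction n using Nat.strong_induction_on with
  | _ n ih =>
    intro E hEn hE
    rcases lt_or_ge n b with hnb | hnb
    · have h1 : E.card ≤ n * n := by
        have : E ⊆ Finset.range n ×ˢ Finset.range n := fun p hp => by
          simpa using hEn p hp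
        simpa using Finset.card_le_card this
      exact h1.trans (Nat.mul_le_mul_right _ (by omega))
    · set m := n / b + 1 with hm
      have hmb : m * b ≤ 2 * n := by
        have := Nat.div_mul_le_self n b
        rw [hm, add_mul]
        omega
      have hmn : m < n := by
        have h4 : 4 * m ≤ 2 * n := le_trans (by rw [mul_comm]; gcongr; omega) hmb
        omega
      have hdiv : ∀ a, a < n → a / b < m := fun a ha =>
        Nat.lt_succ_of_le (Nat.div_le_div_right ha.le)
      have h1 := card_le_of_blocks hk hb E hE
        (fun p hp => ⟨hdiv _ (hEn p hp).1, hdiv _ (hEn p hp).2⟩)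
      have h2 := ih m hmn (E.image fun p => (p.1 / b, p.2 / b)) (fun q hq => by
        obtain ⟨p, hp, rfl⟩ := Finset.mem_image.1 hq
        exact ⟨hdiv _ (hEn p hp).1, hdiv _ (hEn p hp).2⟩) (fun h => hE (h.comap
          (f := fun a => a / b) (g := fun a => a / b) (fun _ _ h => Nat.div_le_div_right h)
          (fun _ _ h => Nat.div_le_div_right h) fun a c hac => by
            obtain ⟨p, hp, hp'⟩ := Finset.mem_image.1 hac
            simp only [Prod.mk.injEq] at hp'
            exact ⟨p.1, p.2, hp'.1, hp'.2, hp⟩))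
      have h3 : E.card ≤ k * k * ((2 * D + b) * m) + D * m := by
        refine h1.trans (add_le_add (Nat.mul_le_mul_left _ h2) (le_of_eq ?_))
        rw [hD]; ring
      have h4 : 4 * (k * k * ((2 * D + b) * m)) = (2 * D + b) * (m * b) := by
        rw [hbdef]; ring
      have h5 : (2 * D + b) * (m * b) ≤ (2 * D + b) * (2 * n) := Nat.mul_le_mul_left _ hmb
      have h6 : D * m ≤ D * n := Nat.mul_le_mul_left _ hmn.le
      nlinarith [Nat.zero_le (b * n)]

end MarcusTardos


/-! ### Bounded twin-width implies bounded grid number -/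

section Meets

variable {V : Type*}

open Classical in
/-- The indices of the intervals, given by `c`, which meet the part of `w`. -/
noncomputable def meets {k : ℕ} (c : V → Fin k) (s : Setoid V) (w : V) : Finset (Fin k) :=
  Finset.univ.filter fun j => ∃ v, s.r v w ∧ c v = j

theorem mem_meets {k : ℕ} {c : V → Fin k} {s : Setoid V} {w : V} {j : Fin k} :
    j ∈ meets c s w ↔ ∃ v, s.r v w ∧ c v = j := by
  simp [meets]

theorem card_meets_bot_le {k : ℕ} (c : V → Fin k) (w : V) : (meets c ⊥ w).card ≤ 1 := by
  refine (Finset.card_le_card (t := {c w}) fun j hj => ?_).trans (Finset.card_singleton _).le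
  obtain ⟨v, hv, rfl⟩ := mem_meets.1 hj
  have hv : v = w := hv
  simp [hv]

/-- By convexity, the part contains the middle one of three intervals that it meets. -/
theorem exists_fiber_subset [LinearOrder V] {k : ℕ} {c : V → Fin k} (hc : Monotone c)
    {s : Setoid V} {w : V} (hs : Set.OrdConnected {x | s.r x w}) (h : 3 ≤ (meets c s w).card) :
    ∃ q, ∀ v, c v = q → s.r v w := by
  obtain ⟨T, hT, hT3⟩ := Finset.exists_subset_card_eq h
  have hmem : ∀ i, ∃ v, s.r v w ∧ c v = T.orderEmbOfFin hT3 i := fun i =>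
    mem_meets.1 (hT (Finset.orderEmbOfFin_mem T hT3 i))
  obtain ⟨a, ha, hca⟩ := hmem 0
  obtain ⟨b, hb, hcb⟩ := hmem 2
  refine ⟨T.orderEmbOfFin hT3 1, fun v hv => hs.out ha hb ⟨?_, ?_⟩⟩
  · refine (hc.reflect_lt ?_).le
    rw [hca, hv]
    exact (T.orderEmbOfFin hT3).strictMono (by decide)
  · refine (hc.reflect_lt ?_).le
    rw [hcb, hv]
    exact (T.orderEmbOfFin hT3).strictMono (by decide)

theorem MergesTwo.le {r s : Setoid V} (h : MergesTwo r s) {x y : V} (hxy : r.r x y) : s.r x y := by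
  obtain ⟨a, b, -, hs⟩ := h
  exact (hs x y).2 (Or.inl hxy)

theorem MergesTwo.exists_merged {r s : Setoid V} (h : MergesTwo r s) :
    ∃ a b, ∀ w, (s.r w a ∧ ∀ v, s.r v w → r.r v a ∨ r.r v b) ∨ ∀ v, s.r v w → r.r v w := by
  obtain ⟨a, b, -, hs⟩ := h
  refine ⟨a, b, fun w => ?_⟩
  by_cases hw : r.r w a ∨ r.r w b
  · refine Or.inl ⟨(hs w a).2 (Or.inr ⟨hw, Or.inl (r.refl a)⟩), fun v hv => ?_⟩
    rcases (hs v w).1 hv with h | h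
    · exact hw.imp (r.trans h) (r.trans h)
    · exact h.1
  · exact Or.inr fun v hv => ((hs v w).1 hv).resolve_right fun h => hw h.2

theorem MergesTwo.card_meets_le {k : ℕ} {c : V → Fin k} {r s : Setoid V} (h : MergesTwo r s)
    (hr : ∀ w, (meets c r w).card ≤ 2) (w : V) : (meets c s w).card ≤ 4 := by
  classical
  obtain ⟨a, b, hab⟩ := h.exists_merged
  rcases hab w with hw | hw
  · have : meets c s w ⊆ meets c r a ∪ meets c r b := by
      intro j hj
      obtain ⟨v, hv, rfl⟩ := mem_meets.1 hj
      exact Finset.mem_union.2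
        ((hw.2 v hv).imp (fun h => mem_meets.2 ⟨v, h, rfl⟩) fun h => mem_meets.2 ⟨v, h, rfl⟩)
    have h1 := Finset.card_le_card this
    have h2 := Finset.card_union_le (meets c r a) (meets c r b)
    have h3 := hr a
    have h4 := hr b
    omega
  · have : meets c s w ⊆ meets c r w := fun j hj => by
      obtain ⟨v, hv, rfl⟩ := mem_meets.1 hj
      exact mem_meets.2 ⟨v, hw v hv, rfl⟩
    have h1 := Finset.card_le_card this
    have h2 := hr w
    omega

/-- If the part of `w` is new after a merge, then all other parts are unchanged. -/
theorem MergesTwo.meets_subset {k : ℕ} {c d : V → Fin k} {r s : Setoid V} (h : MergesTwo r s)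
    (hr : ∀ w, (meets c r w).card ≤ 2) {w w' : V} (hw : 3 ≤ (meets c s w).card)
    (hw' : ¬ s.r w' w) : meets d s w' ⊆ meets d r w' := by
  obtain ⟨a, b, hab⟩ := h.exists_merged
  have hwa : s.r w a := by
    rcases hab w with h | h
    · exact h.1
    · have : meets c s w ⊆ meets c r w := fun j hj => by
        obtain ⟨v, hv, rfl⟩ := mem_meets.1 hj
        exact mem_meets.2 ⟨v, h v hv, rfl⟩
      have := Finset.card_le_card this
      have := hr w
      omega
  rcases hab w' with h' | h'
  · exact absurd (s.trans h'.1 (s.symm hwa)) hw'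
  · intro j hj
    obtain ⟨v, hv, rfl⟩ := mem_meets.1 hj
    exact mem_meets.2 ⟨v, h' v hv, rfl⟩

/-- The at most `t` parts in `N` meet at most two intervals each. The set `Z` collects intervals
exempt from being covered: those met by the large part itself in a graph, none in a matrix. -/
theorem le_of_meets_cover {k t : ℕ} (r : V → Fin k) (s : Setoid V) (N : Set (Quotient s))
    (hN : N.encard ≤ t) (Z : Finset (Fin k))
    (hs : ∀ v, Quotient.mk s v ∈ N → (meets r s v).card ≤ 2)
    (hcov : ∀ j, j ∉ Z → ∃ v, r v = j ∧ Quotient.mk s v ∈ N) : k ≤ Z.card + 2 * t := by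
  classical
  have hfin : N.Finite := Set.finite_of_encard_le_coe hN
  have hcard : hfin.toFinset.card ≤ t := by
    rw [hfin.encard_eq_coe_toFinset_card] at hN
    exact_mod_cast hN
  have hsub : (Finset.univ : Finset (Fin k)) ⊆
      Z ∪ hfin.toFinset.biUnion fun B => meets r s B.out := by
    intro j _
    by_cases hj : j ∈ Z
    · exact Finset.mem_union_left _ hj
    · obtain ⟨v, rfl, hv⟩ := hcov j hj
      refine Finset.mem_union_right _ (Finset.mem_biUnion.2 ⟨_, hfin.mem_toFinset.2 hv, ?_⟩)
      exact mem_meets.2 ⟨v, s.symm (Quotient.mk_out v), rfl⟩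
  have h1 := Finset.card_le_card hsub
  have h2 := Finset.card_union_le Z (hfin.toFinset.biUnion fun B => meets r s B.out)
  have h3 : (hfin.toFinset.biUnion fun B => meets r s B.out).card ≤ hfin.toFinset.card * 2 :=
    Finset.card_biUnion_le_card_mul _ _ _ fun B hB =>
      hs _ (by rw [Quotient.out_eq]; exact hfin.mem_toFinset.1 hB)
  rw [Finset.card_univ, Fintype.card_fin] at h1
  omega

end Meets

/-! ### Partition sequences of graphs: bounding grids -/

section Graph

variable {V : Type*}

/-- The part of `w` contains a whole interval of `c`, so its edges reach all `k` intervals of `r`.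
They end inside the part itself, which meets at most `2 + 2` intervals of `r`, or in one of at most
`t` neighbouring parts, which the merge left unchanged and which meet at most two each. -/
theorem grid_le_of_mergesTwo [LinearOrder V] {G : SimpleGraph V} {k t : ℕ} {c r : V → Fin k}
    (hc : Monotone c) (hG : ∀ i j, ∃ x y, c x = i ∧ r y = j ∧ G.Adj x y)
    {p s : Setoid V} (hps : MergesTwo p s) (hs : IsIntervalPartition s)
    (hpc : ∀ w, (meets c p w).card ≤ 2) (hpr : ∀ w, (meets r p w).card ≤ 2)
    (ht : graphMaxDegree (quotientGraph G s) ≤ t) {w : V} (hw : 3 ≤ (meets c s w).card) :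
    k ≤ 4 + 2 * t := by
  obtain ⟨q, hq⟩ := exists_fiber_subset hc (hs w) hw
  have hN : ((quotientGraph G s).neighborSet (Quotient.mk s w)).encard ≤ t :=
    (le_iSup (fun v => ((quotientGraph G s).neighborSet v).encard) _).trans ht
  refine (le_of_meets_cover r s _ hN (meets r s w) (fun v hv => ?_) fun j hj => ?_).trans
    (Nat.add_le_add_right (hps.card_meets_le hpr w) _)
  · refine (Finset.card_le_card (hps.meets_subset hpc hw fun h => ?_)).trans (hpr v)
    exact hv.1 (Quotient.sound (s.symm h))
  · obtain ⟨x, y, hx, rfl, hxy⟩ := hG q j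
    refine ⟨y, rfl, fun h => hj (mem_meets.2 ⟨y, s.symm (Quotient.exact h), rfl⟩), x, y,
      Quotient.sound (hq x hx), rfl, hxy⟩

/-- Singletons meet one interval and the final part meets all of them, so there is a first index at
which some part meets three intervals of `c` or of `r`. Just before it all parts meet at most two,
and `grid_le_of_mergesTwo` applies. -/
theorem PartitionSequence.grid_le [LinearOrder V] (P : PartitionSequence V)
    (hP : ∀ i ≤ P.length, IsIntervalPartition (P.part i)) {G : SimpleGraph V} {t : ℕ}
    (hw : P.width G ≤ t) {k : ℕ} (h : HasGrid G.Adj k) : k ≤ 4 + 2 * t := by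
  classical
  obtain ⟨c, r, hc, hr, hG⟩ := h
  by_contra! hk
  have hex : ∃ i, i ≤ P.length ∧
      ∃ w, 3 ≤ (meets c (P.part i) w).card ∨ 3 ≤ (meets r (P.part i) w).card := by
    obtain ⟨w, -⟩ := hG ⟨0, by omega⟩ ⟨0, by omega⟩
    refine ⟨P.length, le_rfl, w, Or.inl ?_⟩
    have : meets c (P.part P.length) w = Finset.univ := by
      refine Finset.eq_univ_of_forall fun i => mem_meets.2 ?_
      obtain ⟨x, -, hx, -⟩ := hG i i
      exact ⟨x, by rw [P.part_length]; trivial, hx⟩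
    rw [this, Finset.card_univ, Fintype.card_fin]
    omega
  obtain ⟨hle, w, hw3⟩ := Nat.find_spec hex
  have hmin := fun m => Nat.find_min hex (m := m)
  cases hi : Nat.find hex with
  | zero =>
    rw [hi, P.part_zero] at hw3
    have h1 := card_meets_bot_le c w
    have h2 := card_meets_bot_le r w
    omega
  | succ j =>
    rw [hi] at hle hw3 hmin
    have hsmall : ∀ v, (meets c (P.part j) v).card ≤ 2 ∧ (meets r (P.part j) v).card ≤ 2 := by
      intro v
      by_contra hv
      exact hmin j (by omega) ⟨by omega, v, by omega⟩
    have hdeg : graphMaxDegree (quotientGraph G (P.part (j + 1))) ≤ t :=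
      (le_iSup (fun i : {i : ℕ // i ≤ P.length} => graphMaxDegree (quotientGraph G (P.part i)))
        ⟨j + 1, hle⟩).trans hw
    rcases hw3 with hw3 | hw3
    · exact hk.not_ge (grid_le_of_mergesTwo hc hG (P.merges j hle) (hP _ hle)
        (fun v => (hsmall v).1) (fun v => (hsmall v).2) hdeg hw3)
    · refine hk.not_ge (grid_le_of_mergesTwo hr (fun i j => ?_) (P.merges j hle) (hP _ hle)
        (fun v => (hsmall v).2) (fun v => (hsmall v).1) hdeg hw3)
      obtain ⟨x, y, hx, hy, hxy⟩ := hG j i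
      exact ⟨y, x, hy, hx, hxy.symm⟩

theorem PartitionSequence.part_mono (P : PartitionSequence V) {i j : ℕ} (hij : i ≤ j)
    (hj : j ≤ P.length) {x y : V} (h : (P.part i).r x y) : (P.part j).r x y := by
  induction j, hij using Nat.le_induction with
  | base => exact h
  | succ j _ ih => exact (P.merges j hj).le (ih (by omega))

theorem isIntervalPartition_lift' {K : Type*} [LinearOrder K] {key : V → K}
    (hkey : Function.Injective key) {r : Setoid V}
    (h : ∀ x y z, r.r x y → key x ≤ key z → key z ≤ key y → r.r z x) :
    @IsIntervalPartition V (LinearOrder.lift' key hkey) r := by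
  let := LinearOrder.lift' key hkey
  exact fun a => ⟨fun x hx y hy z hz =>
    r.trans (h x y z (r.trans hx (r.symm hy)) hz.1 hz.2) hx⟩

/-- The parts of a partition sequence are simultaneously intervals of some order. -/
theorem PartitionSequence.exists_linearOrder (P : PartitionSequence V) :
    ∃ o : LinearOrder V, ∀ i ≤ P.length, @IsIntervalPartition V o (P.part i) := by
  classical
  let o₀ : LinearOrder V := linearOrderOfSTO WellOrderingRel
  -- The key lists representatives of the parts containing `x`, from the coarsest partition to the
  -- finest; `o₀` only serves to compare representatives. Two elements of one part of `part i` share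
  -- the coordinates up to `P.length - i`, hence so does anything lexicographically between them.
  -- Singletons at coordinate `P.length` give injectivity.
  let key : V → Lex (ℕ → V) := fun x =>
    toLex fun j => (Quotient.mk (P.part (P.length - j)) x).out
  have hkey : ∀ x j, ofLex (key x) j = (Quotient.mk (P.part (P.length - j)) x).out := fun _ _ => rfl
  have hinj : Function.Injective key := by
    intro x y hxy
    have h1 : ofLex (key x) P.length = ofLex (key y) P.length := by rw [hxy]
    have h2 := congrArg (Quotient.mk (P.part (P.length - P.length))) h1
    rw [hkey, hkey, Quotient.out_eq, Quotient.out_eq] at h2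
    have : (P.part (P.length - P.length)).r x y := Quotient.exact h2
    rw [Nat.sub_self, P.part_zero] at this
    exact this
  refine ⟨LinearOrder.lift' key hinj, fun i hi =>
    isIntervalPartition_lift' hinj fun x y z hxy hxz hzy => ?_⟩
  have hagree : ∀ x y, (P.part i).r x y → ∀ j ≤ P.length - i, ofLex (key x) j = ofLex (key y) j := by
    intro x y hxy j hj
    rw [hkey, hkey]
    congr 1
    exact Quotient.sound (P.part_mono (by omega) (by omega) hxy)
  have hxy := hagree x y hxy
  have main : ∀ j ≤ P.length - i, ofLex (key z) j = ofLex (key x) j := by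
    intro j
    induction j using Nat.strong_induction_on with
    | _ j ih =>
      intro hj
      by_contra hne
      rcases lt_or_gt_of_ne hne with h | h
      · exact hxz.not_gt ⟨j, fun l hl => ih l hl (by omega), h⟩
      · exact hzy.not_gt ⟨j, fun l (hl : l < j) =>
          (hxy l (by omega)).symm.trans (ih l hl (by omega)).symm, (hxy j hj).symm.trans_lt h⟩
  have := main (P.length - i) le_rfl
  rw [hkey, hkey, Nat.sub_sub_self hi] at this
  have h2 := congrArg (Quotient.mk (P.part i)) this
  rw [Quotient.out_eq, Quotient.out_eq] at h2
  exact Quotient.exact h2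

/-- Compactness: a relation has an order without `k`-grids as soon as all its restrictions to finite
sets do. -/
theorem exists_linearOrder_not_hasGrid (R : V → V → Prop) {k : ℕ} (hk : 0 < k)
    (h : ∀ H : Finset V, ∃ o : LinearOrder (H : Set V),
      ¬ @HasGrid _ _ o o (fun x y : (H : Set V) => R x y) k) :
    ∃ o : LinearOrder V, ¬ @HasGrid V V o o R k := by
  classical
  choose o ho using h
  -- Points are compared as they are in almost all of the finite orders, with respect to an
  -- ultrafilter for which almost every finite set contains any given point.
  let U : Ultrafilter (Finset V) := Ultrafilter.of Filter.atTop
  have hU : (U : Filter (Finset V)) ≤ Filter.atTop := Ultrafilter.of_le _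
  have hmem : ∀ x, ∀ᶠ H in (U : Filter (Finset V)), x ∈ H := fun x =>
    hU ((Filter.eventually_ge_atTop {x}).mono fun H hH => hH (Finset.mem_singleton_self x))
  let le : V → V → Prop := fun x y => ∀ᶠ H in (U : Filter (Finset V)),
    ∃ (hx : x ∈ H) (hy : y ∈ H), (o H).le ⟨x, hx⟩ ⟨y, hy⟩
  have hantisymm : ∀ x y, le x y → le y x → x = y := by
    intro x y h1 h2
    obtain ⟨H, ⟨hx, hy, h1⟩, _, _, h2⟩ := (h1.and h2).exists
    exact congrArg Subtype.val ((o H).le_antisymm _ _ h1 h2)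
  let O : LinearOrder V :=
    { le := le
      le_refl := fun x => (hmem x).mono fun H hH => ⟨hH, hH, (o H).le_refl _⟩
      le_trans := fun x y z h1 h2 => by
        filter_upwards [h1, h2] with H ⟨hx, hy, h1⟩ ⟨_, hz, h2⟩
        exact ⟨hx, hz, (o H).le_trans _ _ _ h1 h2⟩
      le_antisymm := hantisymm
      le_total := fun x y => by
        refine Ultrafilter.eventually_or.1 ?_
        filter_upwards [hmem x, hmem y] with H hx hy
        exact ((o H).le_total ⟨x, hx⟩ ⟨y, hy⟩).imp (fun h => ⟨hx, hy, h⟩) fun h => ⟨hy, hx, h⟩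
      toDecidableLE := Classical.decRel _ }
  refine ⟨O, fun hgrid => ?_⟩
  obtain ⟨x, y, hx, hy, hR⟩ := hgrid.exists_points
  have hlt : ∀ a b, O.lt a b → ∀ᶠ H in (U : Filter (Finset V)),
      ∀ (ha : a ∈ H) (hb : b ∈ H), (o H).lt ⟨a, ha⟩ ⟨b, hb⟩ := by
    intro a b hab
    have hab' : le a b := @le_of_lt V O.toPreorder a b hab
    filter_upwards [hab'] with H ⟨ha, hb, h⟩ _ _
    refine @lt_of_le_of_ne _ (o H).toPartialOrder _ _ h fun heq => ?_
    exact @ne_of_lt V O.toPreorder a b hab (congrArg Subtype.val heq)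
  -- A `k`-grid is witnessed by finitely many points and inequalities, so all of these hold together
  -- in some finite `H`.
  have hx' := Filter.eventually_all.2 fun i => Filter.eventually_all.2 fun i' =>
    Filter.eventually_all.2 fun j => Filter.eventually_all.2 fun j' =>
      Filter.eventually_imp_distrib_left.2 fun hi => hlt _ _ (hx i i' j j' hi)
  have hy' := Filter.eventually_all.2 fun i => Filter.eventually_all.2 fun i' =>
    Filter.eventually_all.2 fun j => Filter.eventually_all.2 fun j' =>
      Filter.eventually_imp_distrib_left.2 fun hj => hlt _ _ (hy i i' j j' hj)
  have hxm := Filter.eventually_all.2 fun i => Filter.eventually_all.2 fun j => hmem (x i j)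
  have hym := Filter.eventually_all.2 fun i => Filter.eventually_all.2 fun j => hmem (y i j)
  obtain ⟨H, ⟨h1, h2⟩, h3, h4⟩ := ((hx'.and hy').and (hxm.and hym)).exists
  exact ho H (@hasGrid_of_points _ _ (o H) (o H) _ k hk (fun i j => ⟨x i j, h3 i j⟩)
    (fun i j => ⟨y i j, h4 i j⟩) (fun i i' j j' hi => h1 i i' j j' hi _ _)
    (fun i i' j j' hj => h2 i i' j j' hj _ _) hR)

theorem exists_le_of_iInf_le {ι : Type*} {f : ι → ℕ∞} {t : ℕ} (h : ⨅ i, f i ≤ t) :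
    ∃ i, f i ≤ t := by
  have hlt : (t : ℕ∞) < t + 1 := (ENat.lt_add_one_iff (ENat.natCast_ne_top t)).2 le_rfl
  obtain ⟨i, hi⟩ := iInf_lt_iff.1 (h.trans_lt hlt)
  exact ⟨i, (ENat.lt_add_one_iff (ENat.natCast_ne_top t)).1 hi⟩

/-- Each finite subgraph has its own order, adapted to its own partition sequence, and grids have
size at most `4 + 2 * t` there; compactness supplies a single order. -/
theorem graphGridNumber_lt_top_of_graphStww {G : SimpleGraph V} (h : graphStww G < ⊤) :
    graphGridNumber G < ⊤ := by
  obtain ⟨t, ht⟩ := ENat.ne_top_iff_exists.1 h.ne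
  obtain ⟨o, ho⟩ := exists_linearOrder_not_hasGrid G.Adj (k := 5 + 2 * t) (by omega) fun H => by
    obtain ⟨P, hP⟩ := exists_le_of_iInf_le ((le_iSup (fun H : Finset V =>
      finGraphStww (G.induce (H : Set V))) H).trans ht.ge)
    obtain ⟨o, ho⟩ := P.exists_linearOrder
    refine ⟨o, fun hg => ?_⟩
    have := P.grid_le ho hP hg
    omega
  exact (iInf_le _ o).trans_lt (matrixGridNumber_lt_top_iff.2 ⟨_, by omega, ho⟩)

end Graph

/-! ### Division sequences of matrices: bounding grids -/

section Matrix

theorem grid_le_of_col {X Y : Type*} [LinearOrder X] {M : X → Y → Prop} {k t : ℕ} {c : X → Fin k} {r : Y → Fin k}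
    (hc : Monotone c) (hM : ∀ i j, ∃ x y, c x = i ∧ r y = j ∧ M x y)
    {s : Setoid X} {s' : Setoid Y} (hs : IsIntervalPartition s)
    (hr : ∀ w, (meets r s' w).card ≤ 2)
    (ht : ∀ A, {B | quotientMatrix M s s' A B}.encard ≤ t) {w : X}
    (hw : 3 ≤ (meets c s w).card) : k ≤ 2 * t := by
  obtain ⟨q, hq⟩ := exists_fiber_subset hc (hs w) hw
  simpa using le_of_meets_cover r s' _ (ht (Quotient.mk s w)) ∅ (fun v _ => hr v) fun j _ => by
    obtain ⟨x, y, hx, rfl, hxy⟩ := hM q j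
    exact ⟨y, rfl, x, y, Quotient.sound (hq x hx), rfl, hxy⟩

variable {X Y : Type*} [LinearOrder X] [LinearOrder Y]

/-- As for graphs, at the first index at which a part on either side meets three intervals. The
bound from the degrees is `2 * t`; the extra `2` ensures that the final division has such a part. -/
theorem DivisionSequence.grid_le (D : DivisionSequence X Y) {M : X → Y → Prop} {t : ℕ}
    (hw : D.width M ≤ t) {k : ℕ} (h : HasGrid M k) : k ≤ 2 + 2 * t := by
  classical
  obtain ⟨c, r, hc, hr, hM⟩ := h
  by_contra! hk
  have hex : ∃ i, i ≤ D.length ∧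
      ((∃ w, 3 ≤ (meets c (D.col i) w).card) ∨ ∃ w, 3 ≤ (meets r (D.row i) w).card) := by
    obtain ⟨w, -⟩ := hM ⟨0, by omega⟩ ⟨0, by omega⟩
    refine ⟨D.length, le_rfl, Or.inl ⟨w, ?_⟩⟩
    have : meets c (D.col D.length) w = Finset.univ := by
      refine Finset.eq_univ_of_forall fun i => mem_meets.2 ?_
      obtain ⟨x, -, hx, -⟩ := hM i i
      exact ⟨x, by rw [D.col_length]; trivial, hx⟩
    rw [this, Finset.card_univ, Fintype.card_fin]
    omega
  obtain ⟨hle, hw3⟩ := Nat.find_spec hex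
  have hmin := fun m => Nat.find_min hex (m := m)
  cases hi : Nat.find hex with
  | zero =>
    rw [hi, D.col_zero, D.row_zero] at hw3
    rcases hw3 with ⟨w, hw⟩ | ⟨w, hw⟩
    · have h1 := card_meets_bot_le c w
      omega
    · have h1 := card_meets_bot_le r w
      omega
  | succ j =>
    rw [hi] at hle hw3 hmin
    have hcol : ∀ v, (meets c (D.col j) v).card ≤ 2 := fun v => by
      by_contra hv
      exact hmin j (by omega) ⟨by omega, Or.inl ⟨v, by omega⟩⟩
    have hrow : ∀ v, (meets r (D.row j) v).card ≤ 2 := fun v => by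
      by_contra hv
      exact hmin j (by omega) ⟨by omega, Or.inr ⟨v, by omega⟩⟩
    have hdeg : matrixMaxDegree (quotientMatrix M (D.col (j + 1)) (D.row (j + 1))) ≤ t :=
      (le_iSup (fun i : {i : ℕ // i ≤ D.length} =>
        matrixMaxDegree (quotientMatrix M (D.col i) (D.row i))) ⟨j + 1, hle⟩).trans hw
    have hdeg1 := iSup_le_iff.1 (le_sup_left.trans hdeg)
    have hdeg2 := iSup_le_iff.1 (le_sup_right.trans hdeg)
    -- A step merges on one side only, so the other side still has all its parts meeting at most two
    -- intervals.
    have hcase : (∃ w, 3 ≤ (meets c (D.col (j + 1)) w).card ∧ D.row (j + 1) = D.row j) ∨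
        ∃ w, 3 ≤ (meets r (D.row (j + 1)) w).card ∧ D.col (j + 1) = D.col j := by
      rcases D.merges j hle with ⟨-, h⟩ | ⟨h, -⟩
      · rcases hw3 with ⟨w, hw⟩ | ⟨w, hw⟩
        · exact Or.inl ⟨w, hw, h⟩
        · rw [h] at hw
          exact absurd (hrow w) (by omega)
      · rcases hw3 with ⟨w, hw⟩ | ⟨w, hw⟩
        · rw [h] at hw
          exact absurd (hcol w) (by omega)
        · exact Or.inr ⟨w, hw, h⟩
    rcases hcase with ⟨w, hw, h⟩ | ⟨w, hw, h⟩
    · have := grid_le_of_col hc hM (D.col_interval _ hle) (by rwa [h]) hdeg1 hw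
      omega
    · have := grid_le_of_col (M := fun y x => M x y) hr (fun i j => by
          obtain ⟨x, y, hx, hy, hxy⟩ := hM j i
          exact ⟨y, x, hy, hx, hxy⟩) (D.row_interval _ hle) (s' := D.col (j + 1)) (by rwa [h])
        (fun B => by
          refine le_trans (Set.encard_le_encard fun A hA => ?_) (hdeg2 B)
          obtain ⟨y, x, hy, hx, hxy⟩ := hA
          exact ⟨x, y, hx, hy, hxy⟩) hw
      omega

/-- The order is given here, so no compactness is needed: a grid already appears in the finite
submatrix spanned by its representatives. -/
theorem matrixGridNumber_lt_top_of_matrixStww {M : X → Y → Prop} (h : matrixStww M < ⊤) :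
    matrixGridNumber M < ⊤ := by
  classical
  obtain ⟨t, ht⟩ := ENat.ne_top_iff_exists.1 h.ne
  refine matrixGridNumber_lt_top_iff.2 ⟨3 + 2 * t, by omega, fun hg => ?_⟩
  obtain ⟨c, r, hc, hr, hM⟩ := hg
  choose x y hx hy hM using hM
  let X' : Finset X := Finset.univ.image fun p : Fin (3 + 2 * t) × Fin (3 + 2 * t) => x p.1 p.2
  let Y' : Finset Y := Finset.univ.image fun p : Fin (3 + 2 * t) × Fin (3 + 2 * t) => y p.1 p.2
  have hX' : ∀ i j, x i j ∈ X' := fun i j =>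
    Finset.mem_image_of_mem (fun p : Fin _ × Fin _ => x p.1 p.2) (Finset.mem_univ (i, j))
  have hY' : ∀ i j, y i j ∈ Y' := fun i j =>
    Finset.mem_image_of_mem (fun p : Fin _ × Fin _ => y p.1 p.2) (Finset.mem_univ (i, j))
  have hle : finMatrixStww (fun (x : {x : X // x ∈ X'}) (y : {y : Y // y ∈ Y'}) => M x y) ≤ t :=
    (le_iSup₂ (f := fun (X' : Finset X) (Y' : Finset Y) =>
      finMatrixStww (fun (x : {x : X // x ∈ X'}) (y : {y : Y // y ∈ Y'}) => M x y)) X' Y').trans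
      ht.ge
  obtain ⟨D, hD⟩ := exists_le_of_iInf_le hle
  have := D.grid_le hD (k := 3 + 2 * t) ⟨fun x => c x, fun y => r y, fun a b h => hc h,
    fun a b h => hr h, fun i j => ⟨⟨x i j, hX' i j⟩, ⟨y i j, hY' i j⟩, hx i j, hy i j, hM i j⟩⟩
  omega

end Matrix


/-! ### Bounded grid number implies bounded twin-width -/

/-- Every row of `Q` has at most `t` entries equal to `1`. -/
def RowDegreeLE {A B : Type*} (Q : A → B → Prop) (t : ℕ) : Prop :=
  ∀ a, {b | Q a b}.encard ≤ t

/-! ### Merging two consecutive intervals -/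

section Merge

variable {V : Type*}

theorem val_predAbove {p : ℕ} (i : Fin (p + 1)) (v : Fin (p + 2)) :
    (i.predAbove v : ℕ) = if (i : ℕ) < v then (v : ℕ) - 1 else v := by
  unfold Fin.predAbove
  by_cases h : i.castSucc < v
  · have h' : (i : ℕ) < v := h
    simp [h, h']
  · have h' : ¬ (i : ℕ) < v := h
    simp [h, h']

theorem predAbove_eq_predAbove_iff {p : ℕ} {i : Fin (p + 1)} {v w : Fin (p + 2)} :
    i.predAbove v = i.predAbove w ↔
      v = w ∨ ((v = i.castSucc ∨ v = i.succ) ∧ (w = i.castSucc ∨ w = i.succ)) := by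
  simp only [Fin.ext_iff, val_predAbove, Fin.val_castSucc, Fin.val_succ]
  split_ifs <;> omega

/-- Divisions are encoded by surjective monotone index maps. Since `i.predAbove` identifies `i` and
`i + 1` and nothing else, composing with it merges two consecutive intervals; surjectivity makes
both of them nonempty. -/
theorem mergesTwo_ker_predAbove {p : ℕ} {c : V → Fin (p + 2)} (hc : Function.Surjective c)
    (i : Fin (p + 1)) : MergesTwo (Setoid.ker c) (Setoid.ker (i.predAbove ∘ c)) := by
  obtain ⟨a, ha⟩ := hc i.castSucc
  obtain ⟨b, hb⟩ := hc i.succ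
  refine ⟨a, b, fun h => ?_, fun x y => ?_⟩
  · have h : c a = c b := h
    rw [ha, hb] at h
    exact (Fin.castSucc_lt_succ (i := i)).ne h
  · change i.predAbove (c x) = i.predAbove (c y) ↔
      (c x = c y ∨ ((c x = c a ∨ c x = c b) ∧ (c y = c a ∨ c y = c b)))
    rw [ha, hb, predAbove_eq_predAbove_iff]

theorem isIntervalPartition_ker [LinearOrder V] {n : ℕ} {c : V → Fin n} (hc : Monotone c) :
    IsIntervalPartition (Setoid.ker c) := fun a =>
  ⟨fun x (hx : c x = c a) y (hy : c y = c a) _ hz =>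
    le_antisymm ((hc hz.2).trans hy.le) (hx.ge.trans (hc hz.1))⟩

theorem ker_eq_top_of_subsingleton {B : Type*} [Subsingleton B] (c : V → B) :
    Setoid.ker c = ⊤ :=
  Setoid.ext fun _ _ => ⟨fun _ => trivial, fun _ => Subsingleton.elim _ _⟩

theorem ker_eq_bot_of_injective {B : Type*} {c : V → B} (hc : Function.Injective c) :
    Setoid.ker c = ⊥ :=
  Setoid.ext fun _ _ => ⟨fun h => hc h, fun h => congrArg c h⟩

theorem encard_quotient_ker_le {B : Type*} (c : V → B) (P : Set (Quotient (Setoid.ker c)))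
    (Q : Set B) (h : ∀ v, Quotient.mk _ v ∈ P → c v ∈ Q) : P.encard ≤ Q.encard := by
  rw [← (Setoid.kerLift_injective c).encard_image]
  refine Set.encard_le_encard ?_
  rintro _ ⟨A, hA, rfl⟩
  induction A using Quotient.inductionOn with
  | _ v => exact h v hA

/-- In a relation without `k`-grids which has at least as many rows as columns, two consecutive
rows can be merged into a row of small degree. -/
theorem exists_rowDegreeLE_predAbove (k : ℕ) (hk : 0 < k) :
    ∃ C : ℕ, ∀ t, C ≤ t → ∀ (p m : ℕ), m ≤ p + 2 → ∀ Q : Fin (p + 2) → Fin m → Prop,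
      RowDegreeLE Q t → ¬ HasGrid Q k →
      ∃ i : Fin (p + 1), RowDegreeLE (fun u b => ∃ v, i.predAbove v = u ∧ Q v b) t := by
  classical
  obtain ⟨C, hC⟩ := exists_card_le_of_not_hasGrid k hk
  refine ⟨4 * C, fun t ht p m hm Q hQ hgrid => ?_⟩
  let F : Finset (Fin (p + 2) × Fin m) := Finset.univ.filter fun q => Q q.1 q.2
  let e : Fin (p + 2) × Fin m → ℕ × ℕ := fun q => (q.1, q.2)
  have he : Function.Injective e := fun q q' h => by
    simp only [e, Prod.mk.injEq] at h
    exact Prod.ext (Fin.ext h.1) (Fin.ext h.2)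
  let d : Fin (p + 2) → ℕ := fun v => (Finset.univ.filter fun b => Q v b).card
  have hd : ∀ v, {b | Q v b}.encard = d v := fun v => by
    rw [← Set.encard_coe_eq_coe_finsetCard]
    simp
  have hF : F.card = ∑ v, d v := by
    rw [Finset.card_eq_sum_card_fiberwise (f := Prod.fst) (t := Finset.univ)
      (fun _ _ => Finset.mem_coe.2 (Finset.mem_univ _))]
    refine Finset.sum_congr rfl fun v _ => ?_
    refine Finset.card_bij' (fun q _ => q.2) (fun b _ => (v, b)) ?_ ?_ ?_ ?_ <;> simp [F]
    · rintro a b h rfl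
      exact h
    · exact fun _ _ _ h => h.symm
  have hcard := hC (p + 2) (F.image e) (fun q hq => by
      obtain ⟨a, -, rfl⟩ := Finset.mem_image.1 hq
      exact ⟨a.1.2, a.2.2.trans_le hm⟩)
    (fun h => hgrid (h.comap (f := fun v : Fin (p + 2) => (v : ℕ)) (g := fun b : Fin m => (b : ℕ))
      (fun _ _ h => h) (fun _ _ h => h) fun a b hab => by
        obtain ⟨q, hq, hq'⟩ := Finset.mem_image.1 hab
        simp only [e, Prod.mk.injEq] at hq'
        exact ⟨q.1, q.2, hq'.1, hq'.2, (Finset.mem_filter.1 hq).2⟩))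
  rw [Finset.card_image_of_injective _ he, hF] at hcard
  -- Averaging: over the `p + 1` consecutive pairs, the degree sums add up to at most `2 * C * (p +
  -- 2) ≤ 4 * C * (p + 1)`.
  obtain ⟨i, -, hi⟩ : ∃ i ∈ (Finset.univ : Finset (Fin (p + 1))),
      d i.castSucc + d i.succ ≤ 4 * C := by
    refine Finset.exists_le_of_sum_le Finset.univ_nonempty ?_
    rw [Finset.sum_add_distrib, Finset.sum_const, Finset.card_univ, Fintype.card_fin, smul_eq_mul]
    have h1 := Fin.sum_univ_castSucc d
    have h2 := Fin.sum_univ_succ d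
    nlinarith
  refine ⟨i, fun u => ?_⟩
  by_cases hu : u = i
  · have hsub : {b | ∃ v, i.predAbove v = u ∧ Q v b} ⊆ {b | Q i.castSucc b} ∪ {b | Q i.succ b} := by
      rintro b ⟨v, hv, hb⟩
      have hv := hv.trans (hu.trans (Fin.predAbove_castSucc_self i).symm)
      rw [predAbove_eq_predAbove_iff] at hv
      rcases hv with rfl | ⟨rfl | rfl, -⟩
      · exact Or.inl hb
      · exact Or.inl hb
      · exact Or.inr hb
    refine (Set.encard_le_encard hsub).trans ((Set.encard_union_le _ _).trans ?_)
    rw [hd, hd]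
    exact_mod_cast hi.trans ht
  · by_cases hex : ∃ v, i.predAbove v = u
    · obtain ⟨w, rfl⟩ := hex
      refine le_trans (Set.encard_le_encard ?_) (hQ w)
      rintro b ⟨v, hv, hb⟩
      rcases predAbove_eq_predAbove_iff.1 hv with rfl | ⟨-, rfl | rfl⟩
      · exact hb
      · exact absurd (Fin.predAbove_castSucc_self i) hu
      · exact absurd (Fin.predAbove_succ_self i) hu
    · have : {b | ∃ v, i.predAbove v = u ∧ Q v b} = ∅ :=
        Set.eq_empty_of_forall_notMem fun b ⟨v, hv, _⟩ => hex ⟨v, hv⟩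
      rw [this, Set.encard_empty]
      exact zero_le

theorem exists_seq_of_reflTransGen {α : Type*} {R : α → α → Prop} {a b : α}
    (h : Relation.ReflTransGen R a b) :
    ∃ (n : ℕ) (f : ℕ → α), f 0 = a ∧ f n = b ∧ ∀ i < n, R (f i) (f (i + 1)) := by
  induction h using Relation.ReflTransGen.head_induction_on with
  | refl => exact ⟨0, fun _ => b, rfl, rfl, fun i hi => absurd hi (Nat.not_lt_zero i)⟩
  | @head a c hac _ ih =>
    obtain ⟨n, f, h0, hn, hf⟩ := ih
    refine ⟨n + 1, fun i => Nat.casesOn i a f, rfl, hn, fun i hi => ?_⟩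
    cases i with
    | zero =>
      change R a (f 0)
      rwa [h0]
    | succ i => exact hf i (by omega)

end Merge

/-! ### Contraction of graphs without large grids -/

section Graph

variable {V : Type*}

theorem graphMaxDegree_quotientGraph_ker_le {G : SimpleGraph V} {t n : ℕ} {c : V → Fin n}
    (h : RowDegreeLE (Relation.Map G.Adj c c) t) :
    graphMaxDegree (quotientGraph G (Setoid.ker c)) ≤ t := by
  refine iSup_le fun A => ?_
  induction A using Quotient.inductionOn with
  | _ v =>
    refine (encard_quotient_ker_le c _ {j | Relation.Map G.Adj c c (c v) j} ?_).trans (h (c v))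
    rintro w ⟨-, x, y, hx, hy, hxy⟩
    exact ⟨x, y, hxy, Quotient.exact hx, Quotient.exact hy⟩

/-- Induction on the number of parts. The quotient relation inherits the absence of `k`-grids, so
two consecutive parts can be merged as rows; merging the same parts as columns only lowers row
counts. Entries on the diagonal, absent from the quotient graph, are counted harmlessly. -/
theorem reflTransGen_graph {k t : ℕ} [LinearOrder V] {G : SimpleGraph V}
    (hC : ∀ (p m : ℕ), m ≤ p + 2 → ∀ Q : Fin (p + 2) → Fin m → Prop,
      RowDegreeLE Q t → ¬ HasGrid Q k →
      ∃ i : Fin (p + 1), RowDegreeLE (fun u b => ∃ v, i.predAbove v = u ∧ Q v b) t)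
    (hG : ¬ HasGrid G.Adj k) (n : ℕ) :
    ∀ c : V → Fin n, Monotone c → Function.Surjective c → RowDegreeLE (Relation.Map G.Adj c c) t →
      Relation.ReflTransGen
        (fun p s => MergesTwo p s ∧ graphMaxDegree (quotientGraph G s) ≤ t) (Setoid.ker c) ⊤ := by
  induction n with
  | zero =>
    intro c _ _ _
    rw [ker_eq_top_of_subsingleton c]
  | succ n ih =>
    intro c hc hcs hdeg
    cases n with
    | zero =>
      have : Subsingleton (Fin (0 + 1)) := Fin.subsingleton_iff_le_one.2 le_rfl
      rw [ker_eq_top_of_subsingleton c]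
    | succ p =>
      obtain ⟨i, hi⟩ := hC p (p + 2) le_rfl (Relation.Map G.Adj c c) hdeg fun h =>
        hG (h.comap hc hc fun a b ⟨x, y, hxy, hx, hy⟩ => ⟨x, y, hx, hy, hxy⟩)
      have hdeg' : RowDegreeLE (Relation.Map G.Adj (i.predAbove ∘ c) (i.predAbove ∘ c)) t := by
        intro u
        refine le_trans (Set.encard_le_encard ?_)
          ((Set.encard_image_le i.predAbove _).trans (hi u))
        rintro b ⟨x, y, hxy, rfl, rfl⟩
        exact ⟨c y, ⟨c x, rfl, x, y, hxy, rfl, rfl⟩, rfl⟩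
      exact .head ⟨mergesTwo_ker_predAbove hcs i, graphMaxDegree_quotientGraph_ker_le hdeg'⟩
        (ih _ (i.predAbove_right_monotone.comp hc)
          ((Fin.predAbove_surjective i).comp hcs) hdeg')

/-- The degree bound is needed for the partition into singletons, whose quotient is the graph
itself; thereafter `max C Δ` is preserved by every merge. -/
theorem graphStww_lt_top_of_graphGridNumber {G : SimpleGraph V} (h : graphGridNumber G < ⊤)
    {Δ : ℕ} (hΔ : RowDegreeLE G.Adj Δ) : graphStww G < ⊤ := by
  classical
  obtain ⟨o, ho⟩ := iInf_lt_iff.1 h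
  obtain ⟨k, hk, hgrid⟩ := matrixGridNumber_lt_top_iff.1 ho
  obtain ⟨C, hC⟩ := exists_rowDegreeLE_predAbove k hk
  refine lt_of_le_of_lt (b := ((max C Δ : ℕ) : ℕ∞)) (iSup_le fun H => ?_)
    (ENat.natCast_lt_top _)
  let G' := G.induce (H : Set V)
  let e : (H : Set V) ≃o Fin H.card := (H.orderIsoOfFin rfl).symm
  have hinj : Function.Injective fun x : (H : Set V) => (x : V) := Subtype.val_injective
  have hdeg : RowDegreeLE (Relation.Map G'.Adj e e) (max C Δ) := by
    intro a
    obtain ⟨x, rfl⟩ := e.surjective a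
    calc {b | Relation.Map G'.Adj e e (e x) b}.encard
        ≤ (e '' {y | G'.Adj x y}).encard := Set.encard_le_encard (by
          rintro _ ⟨x', y, hxy, hx, rfl⟩
          obtain rfl := e.injective hx
          exact ⟨y, hxy, rfl⟩)
      _ ≤ {y | G'.Adj x y}.encard := Set.encard_image_le _ _
      _ = ((fun y : (H : Set V) => (y : V)) '' {y | G'.Adj x y}).encard :=
          (hinj.encard_image _).symm
      _ ≤ {y | G.Adj x y}.encard := Set.encard_le_encard (by
          rintro _ ⟨y, hy, rfl⟩
          exact hy)
      _ ≤ Δ := hΔ x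
      _ ≤ _ := by exact_mod_cast le_max_right _ _
  have hgrid' : ¬ HasGrid G'.Adj k := fun hg => hgrid (hg.map hk (f := Subtype.val)
    (g := Subtype.val) (fun _ _ h => h) (fun _ _ h => h) fun x y hxy => hxy)
  obtain ⟨n, f, h0, hn, hf⟩ := exists_seq_of_reflTransGen
    (reflTransGen_graph (hC _ (le_max_left _ _)) hgrid' _ e e.monotone e.surjective hdeg)
  have hker := ker_eq_bot_of_injective e.injective
  refine (iInf_le _ (⟨n, f, h0.trans hker, hn, fun i hi => (hf i hi).1⟩ :
    PartitionSequence (H : Set V))).trans (iSup_le fun ⟨i, hi⟩ => ?_)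
  cases i with
  | zero =>
    change graphMaxDegree (quotientGraph G' (f 0)) ≤ _
    rw [h0]
    exact graphMaxDegree_quotientGraph_ker_le hdeg
  | succ i => exact (hf i hi).2

end Graph

/-! ### Contraction of matrices without large grids -/

section Matrix

variable {X Y : Type*} [LinearOrder X] [LinearOrder Y]

/-- A step of a division sequence, with the resulting division having width at most `t`. -/
def DivisionStep (M : X → Y → Prop) (t : ℕ) (p s : Setoid X × Setoid Y) : Prop :=
  ((MergesTwo p.1 s.1 ∧ s.2 = p.2) ∨ (s.1 = p.1 ∧ MergesTwo p.2 s.2)) ∧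
    IsIntervalPartition s.1 ∧ IsIntervalPartition s.2 ∧
    matrixMaxDegree (quotientMatrix M s.1 s.2) ≤ t

theorem matrixMaxDegree_quotientMatrix_ker_le {X Y : Type*} {M : X → Y → Prop} {t n m : ℕ}
    {c : X → Fin n} {r : Y → Fin m}
    (h : RowDegreeLE (Relation.Map M c r) t) (h' : RowDegreeLE (flip (Relation.Map M c r)) t) :
    matrixMaxDegree (quotientMatrix M (Setoid.ker c) (Setoid.ker r)) ≤ t := by
  refine sup_le (iSup_le fun A => ?_) (iSup_le fun A => ?_) <;>
    induction A using Quotient.inductionOn with | _ v => ?_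
  · refine (encard_quotient_ker_le r _ {j | Relation.Map M c r (c v) j} ?_).trans (h (c v))
    rintro w ⟨x, y, hx, hy, hxy⟩
    exact ⟨x, y, hxy, Quotient.exact hx, Quotient.exact hy⟩
  · refine (encard_quotient_ker_le c _ {j | Relation.Map M c r j (r v)} ?_).trans (h' (r v))
    rintro w ⟨x, y, hx, hy, hxy⟩
    exact ⟨x, y, hxy, Quotient.exact hx, Quotient.exact hy⟩

/-- Always merge on a side with at least as many parts as the other, as `hC` requires. This controls
the degrees on the merged side, while those on the other side can only drop. -/
theorem reflTransGen_matrix {k t : ℕ} {M : X → Y → Prop}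
    (hC : ∀ (p m : ℕ), m ≤ p + 2 → ∀ Q : Fin (p + 2) → Fin m → Prop,
      RowDegreeLE Q t → ¬ HasGrid Q k →
      ∃ i : Fin (p + 1), RowDegreeLE (fun u b => ∃ v, i.predAbove v = u ∧ Q v b) t)
    (hM : ¬ HasGrid M k) (N : ℕ) :
    ∀ (n m : ℕ), n + m = N → ∀ (c : X → Fin n) (r : Y → Fin m), Monotone c → Monotone r →
      Function.Surjective c → Function.Surjective r →
      RowDegreeLE (Relation.Map M c r) t → RowDegreeLE (flip (Relation.Map M c r)) t →
      Relation.ReflTransGen (DivisionStep M t) (Setoid.ker c, Setoid.ker r) (⊤, ⊤) := by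
  induction N with
  | zero =>
    intro n m hnm c r _ _ _ _ _ _
    obtain rfl : n = 0 := by omega
    obtain rfl : m = 0 := by omega
    rw [ker_eq_top_of_subsingleton c, ker_eq_top_of_subsingleton r]
  | succ N ih =>
    intro n m hnm c r hc hr hcs hrs hdeg hdeg'
    have hQ : ¬ HasGrid (Relation.Map M c r) k := fun h =>
      hM (h.comap hc hr fun a b ⟨x, y, hxy, hx, hy⟩ => ⟨x, y, hx, hy, hxy⟩)
    by_cases hn : 2 ≤ n ∧ m ≤ n
    · obtain ⟨p, rfl⟩ := Nat.exists_eq_add_of_le' hn.1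
      obtain ⟨i, hi⟩ := hC p m hn.2 _ hdeg hQ
      have h1 : RowDegreeLE (Relation.Map M (i.predAbove ∘ c) r) t := by
        intro u
        refine le_trans (Set.encard_le_encard ?_) (hi u)
        rintro b ⟨x, y, hxy, rfl, rfl⟩
        exact ⟨c x, rfl, x, y, hxy, rfl, rfl⟩
      have h2 : RowDegreeLE (flip (Relation.Map M (i.predAbove ∘ c) r)) t := by
        intro u
        refine le_trans (Set.encard_le_encard ?_)
          ((Set.encard_image_le i.predAbove _).trans (hdeg' u))
        rintro b ⟨x, y, hxy, rfl, rfl⟩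
        exact ⟨c x, ⟨x, y, hxy, rfl, rfl⟩, rfl⟩
      have hc' := i.predAbove_right_monotone.comp hc
      have hstep : DivisionStep M t (Setoid.ker c, Setoid.ker r)
          (Setoid.ker (i.predAbove ∘ c), Setoid.ker r) :=
        ⟨Or.inl ⟨mergesTwo_ker_predAbove hcs i, rfl⟩, isIntervalPartition_ker hc',
          isIntervalPartition_ker hr, matrixMaxDegree_quotientMatrix_ker_le h1 h2⟩
      exact .head hstep (ih (p + 1) m (by omega) _ r hc' hr ((Fin.predAbove_surjective i).comp hcs) hrs h1 h2)
    by_cases hm : 2 ≤ m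
    · obtain ⟨p, rfl⟩ := Nat.exists_eq_add_of_le' hm
      obtain ⟨i, hi⟩ := hC p n (by omega) _ hdeg' fun h => hQ h.flip
      have h1 : RowDegreeLE (Relation.Map M c (i.predAbove ∘ r)) t := by
        intro u
        refine le_trans (Set.encard_le_encard ?_)
          ((Set.encard_image_le i.predAbove _).trans (hdeg u))
        rintro b ⟨x, y, hxy, rfl, rfl⟩
        exact ⟨r y, ⟨x, y, hxy, rfl, rfl⟩, rfl⟩
      have h2 : RowDegreeLE (flip (Relation.Map M c (i.predAbove ∘ r))) t := by
        intro u
        refine le_trans (Set.encard_le_encard ?_) (hi u)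
        rintro b ⟨x, y, hxy, rfl, rfl⟩
        exact ⟨r y, rfl, x, y, hxy, rfl, rfl⟩
      have hr' := i.predAbove_right_monotone.comp hr
      have hstep : DivisionStep M t (Setoid.ker c, Setoid.ker r)
          (Setoid.ker c, Setoid.ker (i.predAbove ∘ r)) :=
        ⟨Or.inr ⟨rfl, mergesTwo_ker_predAbove hrs i⟩, isIntervalPartition_ker hc,
          isIntervalPartition_ker hr', matrixMaxDegree_quotientMatrix_ker_le h1 h2⟩
      exact .head hstep (ih n (p + 1) (by omega) c _ hc hr' hcs ((Fin.predAbove_surjective i).comp hrs) h1 h2)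
    · have : Subsingleton (Fin n) := Fin.subsingleton_iff_le_one.2 (by omega)
      have : Subsingleton (Fin m) := Fin.subsingleton_iff_le_one.2 (by omega)
      rw [ker_eq_top_of_subsingleton c, ker_eq_top_of_subsingleton r]

theorem finMatrixStww_le [Finite X] [Finite Y] {k t : ℕ} {M : X → Y → Prop}
    (hC : ∀ (p m : ℕ), m ≤ p + 2 → ∀ Q : Fin (p + 2) → Fin m → Prop,
      RowDegreeLE Q t → ¬ HasGrid Q k →
      ∃ i : Fin (p + 1), RowDegreeLE (fun u b => ∃ v, i.predAbove v = u ∧ Q v b) t)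
    (hM : ¬ HasGrid M k) (hrow : RowDegreeLE M t) (hcol : RowDegreeLE (flip M) t) :
    finMatrixStww M ≤ t := by
  have := Fintype.ofFinite X
  have := Fintype.ofFinite Y
  let e : X ≃o Fin (Fintype.card X) := (Fintype.orderIsoFinOfCardEq X rfl).symm
  let e' : Y ≃o Fin (Fintype.card Y) := (Fintype.orderIsoFinOfCardEq Y rfl).symm
  have h1 : RowDegreeLE (Relation.Map M e e') t := by
    intro a
    obtain ⟨x, rfl⟩ := e.surjective a
    refine le_trans (Set.encard_le_encard ?_) ((Set.encard_image_le e' _).trans (hrow x))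
    rintro _ ⟨x', y, hxy, hx, rfl⟩
    obtain rfl := e.injective hx
    exact ⟨y, hxy, rfl⟩
  have h2 : RowDegreeLE (flip (Relation.Map M e e')) t := by
    intro a
    obtain ⟨y, rfl⟩ := e'.surjective a
    refine le_trans (Set.encard_le_encard ?_) ((Set.encard_image_le e _).trans (hcol y))
    rintro _ ⟨x, y', hxy, rfl, hy⟩
    obtain rfl := e'.injective hy
    exact ⟨x, hxy, rfl⟩
  obtain ⟨n, f, h0, hn, hf⟩ := exists_seq_of_reflTransGen (reflTransGen_matrix hC hM _ _ _ rfl e e'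
    e.monotone e'.monotone e.surjective e'.surjective h1 h2)
  have key : ∀ i ≤ n, IsIntervalPartition (f i).1 ∧ IsIntervalPartition (f i).2 ∧
      matrixMaxDegree (quotientMatrix M (f i).1 (f i).2) ≤ t := by
    intro i hi
    cases i with
    | zero =>
      rw [h0]
      exact ⟨isIntervalPartition_ker e.monotone, isIntervalPartition_ker e'.monotone,
        matrixMaxDegree_quotientMatrix_ker_le h1 h2⟩
    | succ i => exact (hf i hi).2
  let D : DivisionSequence X Y :=
    { length := n
      col := fun i => (f i).1
      row := fun i => (f i).2
      col_interval := fun i hi => (key i hi).1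
      row_interval := fun i hi => (key i hi).2.1
      col_zero := by rw [h0]; exact ker_eq_bot_of_injective e.injective
      row_zero := by rw [h0]; exact ker_eq_bot_of_injective e'.injective
      col_length := by rw [hn]
      row_length := by rw [hn]
      merges := fun i hi => (hf i hi).1 }
  exact (iInf_le _ D).trans (iSup_le fun i => (key i i.2).2.2)

theorem matrixStww_lt_top_of_matrixGridNumber {M : X → Y → Prop} (h : matrixGridNumber M < ⊤)
    {Δ : ℕ} (hrow : RowDegreeLE M Δ) (hcol : RowDegreeLE (flip M) Δ) : matrixStww M < ⊤ := by
  obtain ⟨k, hk, hgrid⟩ := matrixGridNumber_lt_top_iff.1 h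
  obtain ⟨C, hC⟩ := exists_rowDegreeLE_predAbove k hk
  have hΔ : (Δ : ℕ∞) ≤ ((max C Δ : ℕ) : ℕ∞) := by exact_mod_cast le_max_right _ _
  refine lt_of_le_of_lt (b := ((max C Δ : ℕ) : ℕ∞)) (iSup₂_le fun X' Y' => ?_)
    (ENat.natCast_lt_top _)
  refine finMatrixStww_le (hC _ (le_max_left _ _)) (fun hg => hgrid (hg.map hk (f := Subtype.val)
    (g := Subtype.val) (fun _ _ h => h) (fun _ _ h => h) fun x y hxy => hxy))
    (fun x => ?_) fun y => ?_
  · refine le_trans ?_ ((hrow x).trans hΔ)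
    rw [← (Subtype.val_injective (p := fun y => y ∈ Y')).encard_image]
    refine Set.encard_le_encard ?_
    rintro _ ⟨y, hy, rfl⟩
    exact hy
  · refine le_trans ?_ ((hcol y).trans hΔ)
    rw [← (Subtype.val_injective (p := fun x => x ∈ X')).encard_image]
    refine Set.encard_le_encard ?_
    rintro _ ⟨x, hx, rfl⟩
    exact hx

end Matrix


/-! ### Grid numbers of unions and compositions -/

section Operations

variable {X Y Z : Type*} [LinearOrder X] [LinearOrder Y] [LinearOrder Z]

theorem matrixGridNumber_lt_top_of_le {M M' : X → Y → Prop} (h : matrixGridNumber M' < ⊤)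
    (hM : ∀ x y, M x y → M' x y) : matrixGridNumber M < ⊤ := by
  obtain ⟨k, hk, hg⟩ := matrixGridNumber_lt_top_iff.1 h
  exact matrixGridNumber_lt_top_iff.2 ⟨k, hk, fun h => hg (h.mono hM)⟩

theorem matrixGridNumber_flip_lt_top {M : X → Y → Prop} (h : matrixGridNumber M < ⊤) :
    matrixGridNumber (fun y x => M x y) < ⊤ := by
  obtain ⟨k, hk, hg⟩ := matrixGridNumber_lt_top_iff.1 h
  exact matrixGridNumber_lt_top_iff.2 ⟨k, hk, fun h => hg h.flip⟩

/-- In a `2`-grid, diagonal points in the two off-diagonal zones would have to satisfy both `x < y`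
and `y < x`. -/
theorem matrixGridNumber_mapMatrix_id_lt_top : matrixGridNumber (mapMatrix (id : X → X)) < ⊤ := by
  refine matrixGridNumber_lt_top_iff.2 ⟨2, two_pos, ?_⟩
  rintro ⟨c, r, hc, hr, h⟩
  obtain ⟨x, _, hx, hx', rfl⟩ := h 0 1
  obtain ⟨y, _, hy, hy', rfl⟩ := h 1 0
  have h1 : x < y := hc.reflect_lt (by rw [hx, hy]; exact Fin.zero_lt_one)
  have h2 : y < x := hr.reflect_lt (by
    change r (id y) < r (id x)
    rw [hx', hy']
    exact Fin.zero_lt_one)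
  exact h1.asymm h2

/-- A finite union of matrices with finite grid number has finite grid number. -/
theorem matrixGridNumber_lt_top_of_union {ι : Type*} (F : Finset ι) {M : ι → X → Y → Prop}
    {R : X → Y → Prop} (hM : ∀ i ∈ F, matrixGridNumber (M i) < ⊤)
    (hR : ∀ x y, R x y → ∃ i ∈ F, M i x y) : matrixGridNumber R < ⊤ := by
  classical
  have hM' : ∀ i, ∃ k, i ∈ F → 0 < k ∧ ¬ HasGrid (M i) k := fun i => by
    by_cases hi : i ∈ F
    · obtain ⟨k, hk⟩ := matrixGridNumber_lt_top_iff.1 (hM i hi)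
      exact ⟨k, fun _ => hk⟩
    · exact ⟨0, fun h => absurd h hi⟩
  choose k hk using hM'
  have hK : ∀ i ∈ F, ¬ HasGrid (M i) (F.sup k + 1) := fun i hi h =>
    (hk i hi).2 (h.of_le (hk i hi).1 ((Finset.le_sup hi).trans (Nat.le_succ _)))
  obtain ⟨C, hC⟩ := exists_card_le_of_not_hasGrid (F.sup k + 1) (Nat.succ_pos _)
  -- Each matrix `M i` meets at most `C * N` of the zones of an `N`-grid of `R`, so together they
  -- meet at most `F.card * C * N < N * N`.
  set N := F.card * C + 1 with hN
  refine matrixGridNumber_lt_top_iff.2 ⟨N, Nat.succ_pos _, ?_⟩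
  rintro ⟨c, r, hc, hr, h⟩
  let e : Fin N × Fin N ↪ ℕ × ℕ := Fin.valEmbedding.prodMap Fin.valEmbedding
  let E : ι → Finset (Fin N × Fin N) := fun i =>
    Finset.univ.filter fun p => ∃ x y, c x = p.1 ∧ r y = p.2 ∧ M i x y
  have hE : ∀ i ∈ F, (E i).card ≤ C * N := by
    intro i hi
    rw [← Finset.card_map e]
    refine hC N _ (fun q hq => ?_) fun hg => hK i hi ?_
    · obtain ⟨p, -, rfl⟩ := Finset.mem_map.1 hq
      exact ⟨p.1.2, p.2.2⟩
    · refine hg.comap (f := fun x => (c x : ℕ)) (g := fun y => (r y : ℕ)) (fun _ _ h => hc h)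
        (fun _ _ h => hr h) fun a b hab => ?_
      obtain ⟨p, hp, hp'⟩ := Finset.mem_map.1 hab
      obtain ⟨x, y, hx, hy, hxy⟩ := (Finset.mem_filter.1 hp).2
      obtain ⟨rfl, rfl⟩ := Prod.mk.inj hp'
      exact ⟨x, y, congrArg Fin.val hx, congrArg Fin.val hy, hxy⟩
  have hsub : (Finset.univ : Finset (Fin N × Fin N)) ⊆ F.biUnion E := fun p _ => by
    obtain ⟨x, y, hx, hy, hxy⟩ := h p.1 p.2
    obtain ⟨i, hi, hM⟩ := hR x y hxy
    exact Finset.mem_biUnion.2 ⟨i, hi, Finset.mem_filter.2 ⟨Finset.mem_univ _, x, y, hx, hy, hM⟩⟩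
  have h1 := (Finset.card_le_card hsub).trans (Finset.card_biUnion_le_card_mul F E _ hE)
  rw [Finset.card_univ, Fintype.card_prod, Fintype.card_fin, ← mul_assoc] at h1
  have h2 := Nat.le_of_mul_le_mul_right h1 (Nat.succ_pos _)
  omega

theorem card_filter_lt_orderEmbOfFin {n : ℕ} (T : Finset Y) (hT : T.card = n) (m : Fin n) :
    (T.filter (· < T.orderEmbOfFin hT m)).card = m := by
  classical
  have : T.filter (· < T.orderEmbOfFin hT m) =
      (Finset.univ.filter (· < m)).map (T.orderEmbOfFin hT).toEmbedding := by
    ext y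
    simp only [Finset.mem_filter, Finset.mem_map, Finset.mem_univ, true_and]
    constructor
    · rintro ⟨hy, hlt⟩
      rw [← Finset.mem_coe, ← Finset.range_orderEmbOfFin T hT] at hy
      obtain ⟨i, rfl⟩ := hy
      exact ⟨i, (T.orderEmbOfFin hT).lt_iff_lt.1 hlt, rfl⟩
    · rintro ⟨i, hi, rfl⟩
      exact ⟨Finset.orderEmbOfFin_mem _ _ _, (T.orderEmbOfFin hT).lt_iff_lt.2 hi⟩
  rw [this, Finset.card_map, Finset.filter_gt_eq_Iio, Fin.card_Iio]

/-- A finite set of `n * n` points of a linear order can be cut into `n` intervals with `n` points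
each. -/
theorem exists_monotone_card_fiber {n : ℕ} (T : Finset Y) (hT : T.card = n * n) :
    ∃ φ : Y → ℕ, Monotone φ ∧ (∀ y ∈ T, φ y < n) ∧
      ∀ l < n, n ≤ (T.filter fun y => φ y = l).card := by
  classical
  have hrank : Monotone fun y => (T.filter (· < y)).card := fun a b hab =>
    Finset.card_le_card (Finset.monotone_filter_right _ fun y _ hy => lt_of_lt_of_le hy hab)
  -- The interval of `y` is its rank in `T` divided by `n`; ranks of elements of `T` run through all
  -- values below `n * n`.
  refine ⟨fun y => (T.filter (· < y)).card / n, fun a b hab => Nat.div_le_div_right (hrank hab),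
    fun y hy => Nat.div_lt_of_lt_mul ?_, fun l hl => ?_⟩
  · rw [← hT]
    exact Finset.card_lt_card (Finset.filter_ssubset.2 ⟨y, hy, lt_irrefl y⟩)
  · have hsub : Finset.Ico (l * n) (l * n + n) ⊆
        (T.filter fun y => (T.filter (· < y)).card / n = l).image
          fun y => (T.filter (· < y)).card := by
      intro m hm
      rw [Finset.mem_Ico] at hm
      have hmn : m < n * n := by nlinarith
      have := card_filter_lt_orderEmbOfFin T hT ⟨m, hmn⟩
      refine Finset.mem_image.2 ⟨_, Finset.mem_filter.2 ⟨Finset.orderEmbOfFin_mem T hT ⟨m, hmn⟩, ?_⟩,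
        this⟩
      rw [this]
      exact Nat.div_eq_of_lt_le hm.1 (by rw [add_mul, one_mul]; exact hm.2)
    simpa using (Finset.card_le_card hsub).trans Finset.card_image_le

theorem sum_card_le_card_of_fibers {ι : Type*} [Fintype ι] [DecidableEq ι] {n : ℕ} (v : ι → ℕ)
    (hv : Function.Injective v) (D : ℕ → Finset ι) (E : Finset (ℕ × ℕ))
    (hD : ∀ l < n, ∀ i ∈ D l, (l, v i) ∈ E) : ∑ l ∈ Finset.range n, (D l).card ≤ E.card := by
  rw [← Finset.card_sigma]
  refine Finset.card_le_card_of_injOn (fun q => (q.1, v q.2)) (fun q hq => ?_)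
    fun q _ q' _ h => ?_
  · have hq := Finset.mem_sigma.1 hq
    exact hD _ (Finset.mem_range.1 hq.1) _ hq.2
  · obtain ⟨l, i⟩ := q
    obtain ⟨l', i'⟩ := q'
    obtain ⟨rfl, h⟩ := Prod.mk.inj h
    obtain rfl := hv h
    rfl

/-- Take one point in each zone of an `n`-grid of `g ∘ f`, with `n = s * s`, and cut their `n * n`
images in `Y` into `n` intervals of at least `n` points. If an interval involves `a` columns and `b`
rows of the grid, then `a * b ≥ s * s`, so `a + b ≥ s`. Summing gives at least `s * n` incidences of
intervals with columns (`E₁`) or rows (`E₂`). But `E₁` has no larger grids than the transpose of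
`f`, nor `E₂` than `g`, so Marcus–Tardos allows only `(C₁ + C₂) * n < s * n`. -/
theorem matrixGridNumber_comp_lt_top {f : X → Y} {g : Y → Z} (hfi : Function.Injective f)
    (hf : matrixGridNumber (mapMatrix f) < ⊤) (hg : matrixGridNumber (mapMatrix g) < ⊤) :
    matrixGridNumber (mapMatrix (g ∘ f)) < ⊤ := by
  classical
  obtain ⟨k₁, hk₁, hf⟩ := matrixGridNumber_lt_top_iff.1 (matrixGridNumber_flip_lt_top hf)
  obtain ⟨k₂, hk₂, hg⟩ := matrixGridNumber_lt_top_iff.1 hg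
  obtain ⟨C₁, hC₁⟩ := exists_card_le_of_not_hasGrid k₁ hk₁
  obtain ⟨C₂, hC₂⟩ := exists_card_le_of_not_hasGrid k₂ hk₂
  set s := C₁ + C₂ + 1 with hs
  set n := s * s with hn
  have hnpos : 0 < n := Nat.mul_pos (Nat.succ_pos _) (Nat.succ_pos _)
  refine matrixGridNumber_lt_top_iff.2 ⟨n, hnpos, ?_⟩
  rintro ⟨c, r, hc, hr, h⟩
  have h' : ∀ p : Fin n × Fin n, ∃ x, c x = p.1 ∧ r (g (f x)) = p.2 := fun p => by
    obtain ⟨x, _, hx, hy, rfl⟩ := h p.1 p.2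
    exact ⟨x, hx, hy⟩
  choose x hx hxr using h'
  have hxi : Function.Injective fun p => f (x p) := fun p q hpq => by
    have hpq := hfi hpq
    exact Prod.ext (by rw [← hx p, ← hx q, hpq]) (by rw [← hxr p, ← hxr q, hpq])
  let T : Finset Y := Finset.univ.image fun p => f (x p)
  have hT : T.card = n * n := by
    rw [Finset.card_image_of_injective _ hxi, Finset.card_univ, Fintype.card_prod,
      Fintype.card_fin]
  have hxT : ∀ p, f (x p) ∈ T := fun p =>
    Finset.mem_image_of_mem (fun p => f (x p)) (Finset.mem_univ p)
  obtain ⟨φ, hφ, hφn, hφT⟩ := exists_monotone_card_fiber T hT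
  let E₁ : Finset (ℕ × ℕ) := Finset.univ.image fun p => (φ (f (x p)), (p.1 : ℕ))
  let E₂ : Finset (ℕ × ℕ) := Finset.univ.image fun p => (φ (f (x p)), (p.2 : ℕ))
  have hE₁ : E₁.card ≤ C₁ * n := by
    refine hC₁ n E₁ (fun q hq => ?_) fun hgrid => hf ?_
    · obtain ⟨p, -, rfl⟩ := Finset.mem_image.1 hq
      exact ⟨hφn _ (hxT p), p.1.2⟩
    · refine hgrid.comap (g := fun x => (c x : ℕ)) hφ (fun _ _ h => hc h) fun a b hab => ?_
      obtain ⟨p, -, hp⟩ := Finset.mem_image.1 hab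
      obtain ⟨rfl, rfl⟩ := Prod.mk.inj hp
      exact ⟨f (x p), x p, rfl, congrArg Fin.val (hx p), rfl⟩
  have hE₂ : E₂.card ≤ C₂ * n := by
    refine hC₂ n E₂ (fun q hq => ?_) fun hgrid => hg ?_
    · obtain ⟨p, -, rfl⟩ := Finset.mem_image.1 hq
      exact ⟨hφn _ (hxT p), p.2.2⟩
    · refine hgrid.comap (g := fun z => (r z : ℕ)) hφ (fun _ _ h => hr h) fun a b hab => ?_
      obtain ⟨p, -, hp⟩ := Finset.mem_image.1 hab
      obtain ⟨rfl, rfl⟩ := Prod.mk.inj hp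
      exact ⟨f (x p), _, rfl, congrArg Fin.val (hxr p), rfl⟩
  let P : ℕ → Finset (Fin n × Fin n) := fun l => Finset.univ.filter fun p => φ (f (x p)) = l
  have hP : ∀ l < n, n ≤ (P l).card := fun l hl => by
    refine (hφT l hl).trans ?_
    rw [← Finset.card_image_of_injective (P l) hxi]
    refine Finset.card_le_card fun y hy => ?_
    obtain ⟨hyT, hy⟩ := Finset.mem_filter.1 hy
    obtain ⟨p, -, rfl⟩ := Finset.mem_image.1 hyT
    exact Finset.mem_image.2 ⟨p, Finset.mem_filter.2 ⟨Finset.mem_univ _, hy⟩, rfl⟩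
  have hmul : ∀ l < n, s ≤ ((P l).image Prod.fst).card + ((P l).image Prod.snd).card := by
    intro l hl
    have h1 : n ≤ ((P l).image Prod.fst).card * ((P l).image Prod.snd).card := by
      rw [← Finset.card_product]
      exact (hP l hl).trans (Finset.card_le_card fun p hp => Finset.mem_product.2
        ⟨Finset.mem_image_of_mem _ hp, Finset.mem_image_of_mem _ hp⟩)
    by_contra! hlt
    nlinarith
  have hsum₁ := sum_card_le_card_of_fibers (n := n) _ Fin.val_injective
    (fun l => (P l).image Prod.fst) E₁ fun l _ i hi => by
      obtain ⟨p, hp, rfl⟩ := Finset.mem_image.1 hi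
      rw [← (Finset.mem_filter.1 hp).2]
      exact Finset.mem_image_of_mem (fun p => (φ (f (x p)), (p.1 : ℕ))) (Finset.mem_univ p)
  have hsum₂ := sum_card_le_card_of_fibers (n := n) _ Fin.val_injective
    (fun l => (P l).image Prod.snd) E₂ fun l _ i hi => by
      obtain ⟨p, hp, rfl⟩ := Finset.mem_image.1 hi
      rw [← (Finset.mem_filter.1 hp).2]
      exact Finset.mem_image_of_mem (fun p => (φ (f (x p)), (p.2 : ℕ))) (Finset.mem_univ p)
  have hsum := Finset.card_nsmul_le_sum (Finset.range n) _ s fun l hl =>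
    hmul l (Finset.mem_range.1 hl)
  rw [Finset.sum_add_distrib, Finset.card_range, smul_eq_mul, hs] at hsum
  nlinarith

end Operations

/-! ### Cayley graphs -/

section Group

/-- Bijection matrices have at most one entry per row and column, so the degree bound `1` suffices
for the converse. -/
theorem actionFiniteTwinWidth_iff {G X : Type*} [Group G] [MulAction G X] :
    ActionFiniteTwinWidth G X ↔ ActionFiniteGridNumber G X := by
  refine exists_congr fun o => forall_congr' fun g =>
    ⟨matrixGridNumber_lt_top_of_matrixStww, fun h =>
      matrixStww_lt_top_of_matrixGridNumber (Δ := 1) h (fun x => ?_) fun y => ?_⟩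
  · refine Set.encard_le_one_iff.2 fun a b ha hb => ?_
    exact Eq.trans (Eq.symm ha) hb
  · refine Set.encard_le_one_iff.2 fun a b ha hb => ?_
    exact MulAction.injective g (Eq.trans ha (Eq.symm hb))

variable {Γ : Type*} [Group Γ]

/-- The opposite group acts by right multiplication. Matrices of generators lie below the adjacency
matrix; products are compositions and inverses are transposes, so closure induction applies. -/
theorem actionFiniteGridNumber_of_mulCayley {S : Set Γ} (hS : Subgroup.closure S = ⊤)
    (h : graphGridNumber (SimpleGraph.mulCayley S) < ⊤) : ActionFiniteGridNumber Γᵐᵒᵖ Γ := by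
  obtain ⟨o, ho⟩ := iInf_lt_iff.1 h
  have hone : matrixGridNumber (mapMatrix fun x : Γ => MulOpposite.op (1 : Γ) • x) < ⊤ := by
    convert matrixGridNumber_mapMatrix_id_lt_top (X := Γ) using 4 with x
    simp
  refine ⟨o, fun g => ?_⟩
  have hg : g.unop ∈ Subgroup.closure S := hS ▸ Subgroup.mem_top _
  rw [← MulOpposite.op_unop g]
  generalize g.unop = a at hg
  induction hg using Subgroup.closure_induction with
  | mem s hs =>
    -- The graph has no loops, so a generator equal to `1` is not covered by adjacency.
    by_cases h1 : s = 1
    · rwa [h1]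
    · refine matrixGridNumber_lt_top_of_le ho ?_
      rintro x _ rfl
      exact (SimpleGraph.mulCayley_adj' S _ _).2 ⟨by simpa using h1, s, hs, Or.inl rfl⟩
  | one => exact hone
  | mul a b _ _ ha hb =>
    convert matrixGridNumber_comp_lt_top (MulAction.injective (MulOpposite.op a)) ha hb using 4
      with x
    simp [mul_assoc]
  | inv a _ ha =>
    refine matrixGridNumber_lt_top_of_le (matrixGridNumber_flip_lt_top ha) ?_
    rintro x _ rfl
    simp [mapMatrix]

theorem exists_mem_of_mulCayley_adj {S : Set Γ} {x y : Γ} (h : (SimpleGraph.mulCayley S).Adj x y) :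
    ∃ g ∈ S ∪ S⁻¹, x * g = y := by
  obtain ⟨-, g, hg, rfl | rfl⟩ := (SimpleGraph.mulCayley_adj' S x y).1 h
  · exact ⟨g, Or.inl hg, rfl⟩
  · exact ⟨g⁻¹, Or.inr (Set.inv_mem_inv.2 hg), mul_inv_cancel_right y g⟩

/-- The order comes from the action and does not depend on `S`; this is what passes from one
generating set to all of them. -/
theorem mulCayley_of_actionFiniteGridNumber {S : Set Γ} (hS : S.Finite)
    (h : ActionFiniteGridNumber Γᵐᵒᵖ Γ) : graphGridNumber (SimpleGraph.mulCayley S) < ⊤ := by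
  obtain ⟨o, ho⟩ := h
  refine (iInf_le _ o).trans_lt (matrixGridNumber_lt_top_of_union (hS.union hS.inv).toFinset
    (fun g _ => ho (MulOpposite.op g)) fun x y hxy => ?_)
  obtain ⟨g, hg, hgy⟩ := exists_mem_of_mulCayley_adj hxy
  exact ⟨g, (Set.Finite.mem_toFinset _).2 hg, hgy⟩

theorem exists_rowDegreeLE_mulCayley {S : Set Γ} (hS : S.Finite) :
    ∃ Δ, RowDegreeLE (SimpleGraph.mulCayley S).Adj Δ := by
  have hfin := hS.union hS.inv
  refine ⟨hfin.toFinset.card, fun x => ?_⟩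
  rw [← hfin.encard_eq_coe_toFinset_card]
  refine le_trans (Set.encard_le_encard ?_) (Set.encard_image_le (fun g => x * g) (S ∪ S⁻¹))
  exact fun y hxy => exists_mem_of_mulCayley_adj hxy

end Group

end TwinWidth

theorem lemma5p1 (Γ : Type*) [Group Γ] (hΓ : Group.FG Γ) :
    List.TFAE [
      ∃ S : Set Γ, S.Finite ∧ Subgroup.closure S = ⊤ ∧
        TwinWidth.graphStww (SimpleGraph.mulCayley S) < ⊤,
      ∀ S : Set Γ, S.Finite → Subgroup.closure S = ⊤ →
        TwinWidth.graphStww (SimpleGraph.mulCayley S) < ⊤,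
      ∃ S : Set Γ, S.Finite ∧ Subgroup.closure S = ⊤ ∧
        TwinWidth.graphGridNumber (SimpleGraph.mulCayley S) < ⊤,
      ∀ S : Set Γ, S.Finite → Subgroup.closure S = ⊤ →
        TwinWidth.graphGridNumber (SimpleGraph.mulCayley S) < ⊤,
      TwinWidth.ActionFiniteTwinWidth Γᵐᵒᵖ Γ,
      TwinWidth.ActionFiniteGridNumber Γᵐᵒᵖ Γ] := by
  tfae_have 1 → 3 := fun ⟨S, hS, hc, h⟩ =>
    ⟨S, hS, hc, TwinWidth.graphGridNumber_lt_top_of_graphStww h⟩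
  tfae_have 3 → 6 := fun ⟨_, _, hc, h⟩ => TwinWidth.actionFiniteGridNumber_of_mulCayley hc h
  tfae_have 6 → 4 := fun h _ hS _ => TwinWidth.mulCayley_of_actionFiniteGridNumber hS h
  tfae_have 4 → 2 := fun h S hS hc => by
    obtain ⟨Δ, hΔ⟩ := TwinWidth.exists_rowDegreeLE_mulCayley hS
    exact TwinWidth.graphStww_lt_top_of_graphGridNumber (h S hS hc) hΔ
  tfae_have 2 → 1 := fun h => by
    obtain ⟨S, hc, hS⟩ := Group.fg_iff.1 hΓ
    exact ⟨S, hS, hc, h S hS hc⟩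
  tfae_have 5 ↔ 6 := TwinWidth.actionFiniteTwinWidth_iff
  tfae_finish
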